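/- Let $u,v:[0,1]\to[0,\infty)$ be continuous functions, each vanishing at some point of $[0,1]$, and let $k_1,k_2:[0,1]^2\to\mathbb C$ be continuous with $k_i(x,s)=\overline{k_i(s,x)}$ and such that the integral operators $(K_i\varphi)(x)=\int_0^1 k_i(x,s)\varphi(s)\,ds$ on $L_2[0,1]$ are positive, $K_i\ge 0$ ($i=1,2$). Define the bounded self-adjoint operators $$(H_1\varphi)(x)=u(x)\varphi(x)-\int_0^1k_1(x,s)\varphi(s)\,ds,\qquad (H_2\varphi)(x)=v(x)\varphi(x)-\int_0^1k_2(x,s)\varphi(s)\,ds$$ on $L_2[0,1]$, and $$(Tf)(x,y)=(u(x)+v(y))f(x,y)-\int_0^1k_1(x,s)f(s,y)\,ds-\int_0^1k_2(y,t)f(x,t)\,dt$$ on $L_2([0,1]^2)$. For a bounded self-adjoint operator $A$, the discrete spectrum $\sigma_d(A)$ is the set of isolated points of the spectrum $\sigma(A)$ that are eigenvalues of finite multiplicity, and $\sigma_e(A)=\sigma(A)\setminus\sigma_d(A)$ is the essential spectrum. We say that $A$ has the Efimov effect from the left at $\lambda$ if $\lambda\in\sigma_e(A)$, there is $\delta>0$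 with $(\lambda-\delta,\lambda]\cap\sigma_e(A)=\{\lambda\}$, and there is a sequence of eigenvalues $\lambda_n<\lambda$ of $A$ with $\lambda_n\to\lambda$. Suppose that $\sigma_d(H_1)$ has $p$ elements, $0<p<\infty$, and that $\sigma_d(H_2)$ is infinite. Let $\alpha\in\sigma_d(H_1)$ be equal to the left endpoint of one of the connected components (disjoint closed intervals $[S_k,S_k']$, possibly single points) of $\sigma_e(T)$. Then $T$ has the Efimov effect from the left at $\alpha$. Moreover, the negative eigenvalues of $H_2$, repeated according to multiplicity, form an infinite sequence $\beta_1\le\beta_2\le\dots$, and every $\alpha+\beta_n$ is an eigenvalue of $T$ with $\alpha+\beta_n<\alpha$, and $\alpha+\beta_n\to\alpha$. -/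

import Mathlib

open MeasureTheory Filter Topology
open scoped unitInterval ENNReal

namespace Efimov

noncomputable section

/-! ## Discrete and essential spectrum, the Efimov effect -/

section Spectral

variable {E : Type*} [NormedAddCommGroup E] [InnerProductSpace ℂ E]

/-- `x` is an eigenvalue of `A`. -/
def IsEigenvalue (A : E →L[ℂ] E) (x : ℝ) : Prop :=
  Module.End.HasEigenvalue (A : E →ₗ[ℂ] E) (x : ℂ)

/-- The multiplicity of `x` as an eigenvalue of `A`, a natural number or `⊤`
(it is `0` when `x` is not an eigenvalue). -/
def multiplicity (A : E →L[ℂ] E) (x : ℝ) : ℕ∞ :=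
  Cardinal.toENat (Module.rank ℂ (Module.End.eigenspace (A : E →ₗ[ℂ] E) (x : ℂ)))

/-- The discrete spectrum of a bounded self-adjoint operator `A` (whose spectrum is real):
the isolated points of the spectrum that are eigenvalues of finite multiplicity. -/
def discreteSpectrum (A : E →L[ℂ] E) : Set ℝ :=
  {x | x ∈ spectrum ℝ A ∧ (∃ ε > 0, Set.Ioo (x - ε) (x + ε) ∩ spectrum ℝ A = {x}) ∧
    IsEigenvalue A x ∧ multiplicity A x < ⊤}

/-- The essential spectrum of a bounded self-adjoint operator: the rest of the spectrum. -/
def essentialSpectrum (A : E →L[ℂ] E) : Set ℝ :=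
  spectrum ℝ A \ discreteSpectrum A

/-- `x ∈ σ_e(A)` is isolated from the left on the essential spectrum of `A`. -/
def IsLeftIsolated (A : E →L[ℂ] E) (x : ℝ) : Prop :=
  ∃ δ > 0, Set.Ioc (x - δ) x ∩ essentialSpectrum A = {x}

/-- The Efimov effect for `A` from the left at the point `x`. -/
def HasLeftEfimovEffect (A : E →L[ℂ] E) (x : ℝ) : Prop :=
  x ∈ essentialSpectrum A ∧ IsLeftIsolated A x ∧
    ∃ ω : ℕ → ℝ, (∀ n, IsEigenvalue A (ω n)) ∧ (∀ n, ω n < x) ∧ Tendsto ω atTop (𝓝 x)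

/-- `β₀ ≤ β₁ ≤ β₂ ≤ …` is the list of all negative eigenvalues of `A`, each of them repeated
according to its multiplicity. -/
def IsNegativeEigenvalueList (A : E →L[ℂ] E) (β : ℕ → ℝ) : Prop :=
  Monotone β ∧ (∀ n, β n < 0) ∧ ∀ x < 0, {n | β n = x}.encard = multiplicity A x

end Spectral

/-- The left endpoints of the connected components of a set `S` of real numbers. If `S` is the
union of the intervals `[S₁, S₁'], …, [Sₙ, Sₙ']` with `Sₖ ≤ Sₖ' < Sₖ₊₁`,
these are the numbers `S₁, …, Sₙ`. -/
def componentLeftEndpoints (S : Set ℝ) : Set ℝ :=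
  {a | a ∈ S ∧ IsLeast (connectedComponentIn S a) a}

/-! ## The operators -/

/-- The complex Hilbert space `L²(Z)`. -/
abbrev L2 (Z : Type*) [MeasureSpace Z] : Type _ := Lp ℂ 2 (volume : Measure Z)

section Operators

variable {Z : Type*} [TopologicalSpace Z] [CompactSpace Z] [MeasureSpace Z] [BorelSpace Z]

lemma memLp_mul (g : C(Z, ℂ)) (f : L2 Z) : MemLp (fun z => g z * f z) 2 volume :=
  (Lp.memLp f).of_le_mul (c := ‖g‖) ((g.continuous.measurable.aestronglyMeasurable).mul
    (Lp.aestronglyMeasurable f)) (Eventually.of_forall fun z => by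
      rw [norm_mul]
      exact mul_le_mul_of_nonneg_right (g.norm_coe_le_norm z) (norm_nonneg _))

/-- Multiplication by the continuous function `g`: `(M f)(z) = g(z) f(z)`. -/
def mulOp (g : C(Z, ℂ)) : L2 Z →L[ℂ] L2 Z :=
  LinearMap.mkContinuous
    { toFun := fun f => (memLp_mul g f).toLp _
      map_add' := fun f h => by
        rw [← MemLp.toLp_add, MemLp.toLp_eq_toLp_iff]
        filter_upwards [Lp.coeFn_add f h] with z hz
        simp only [hz, Pi.add_apply, mul_add]
      map_smul' := fun c f => by
        rw [RingHom.id_apply, ← MemLp.toLp_const_smul, MemLp.toLp_eq_toLp_iff]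
        filter_upwards [Lp.coeFn_smul c f] with z hz
        simp only [hz, Pi.smul_apply, smul_eq_mul]
        ring }
    ‖g‖ (fun f => Lp.norm_le_mul_norm_of_ae_le_mul (by
      filter_upwards [(memLp_mul g f).coeFn_toLp] with z hz
      change ‖(memLp_mul g f).toLp _ z‖ ≤ _
      rw [hz, norm_mul]
      exact mul_le_mul_of_nonneg_right (g.norm_coe_le_norm z) (norm_nonneg _)))

lemma mulOp_apply (g : C(Z, ℂ)) (f : L2 Z) : mulOp g f =ᵐ[volume] fun z => g z * f z :=
  (memLp_mul g f).coeFn_toLp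

end Operators

section Average

variable {Z : Type*} [MeasureSpace Z]

lemma eLpNorm_average_le (f : L2 (Z × I)) :
    eLpNorm (fun z => ∫ s : I, f (z, s)) 2 (volume : Measure Z) ≤ eLpNorm f 2 volume := by
  have hf : AEStronglyMeasurable f ((volume : Measure Z).prod (volume : Measure I)) :=
    Lp.aestronglyMeasurable f
  have h1 : ∀ᵐ z : Z, ‖∫ s : I, f (z, s)‖ₑ ^ (2 : ℝ) ≤ ∫⁻ s : I, ‖f (z, s)‖ₑ ^ (2 : ℝ) := by
    filter_upwards [hf.prodMk_left] with z hz
    have h2 : ∫⁻ s : I, ‖f (z, s)‖ₑ ≤ (∫⁻ s : I, ‖f (z, s)‖ₑ ^ (2 : ℝ)) ^ (1 / (2 : ℝ)) := by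
      have := eLpNorm_le_eLpNorm_of_exponent_le (p := 1) (q := 2) (by norm_num) hz
      rwa [eLpNorm_one_eq_lintegral_enorm, eLpNorm_eq_lintegral_rpow_enorm_toReal
        (by norm_num) (by norm_num), ENNReal.toReal_ofNat] at this
    calc ‖∫ s : I, f (z, s)‖ₑ ^ (2 : ℝ)
        ≤ ((∫⁻ s : I, ‖f (z, s)‖ₑ ^ (2 : ℝ)) ^ (1 / (2 : ℝ))) ^ (2 : ℝ) := by
          gcongr
          exact (enorm_integral_le_lintegral_enorm _).trans h2
      _ = _ := by rw [← ENNReal.rpow_mul]; norm_num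
  rw [eLpNorm_eq_lintegral_rpow_enorm_toReal (by norm_num) (by norm_num),
    eLpNorm_eq_lintegral_rpow_enorm_toReal (by norm_num) (by norm_num), ENNReal.toReal_ofNat]
  gcongr
  refine (lintegral_mono_ae h1).trans (le_of_eq ?_)
  exact (lintegral_prod _ (hf.enorm.pow_const _)).symm

lemma ae_integrable_slice (f : L2 (Z × I)) : ∀ᵐ z : Z, Integrable fun s : I => f (z, s) := by
  have hf : AEStronglyMeasurable f ((volume : Measure Z).prod (volume : Measure I)) :=
    Lp.aestronglyMeasurable f
  have h2 : ∫⁻ z : Z, ∫⁻ s : I, ‖f (z, s)‖ₑ ^ (2 : ℝ) ≠ ⊤ := by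
    rw [← lintegral_prod _ (hf.enorm.pow_const _)]
    have := lintegral_rpow_enorm_lt_top_of_eLpNorm_lt_top (p := 2) (by norm_num) (by norm_num)
      (Lp.memLp f).2
    exact this.ne
  filter_upwards [hf.prodMk_left, ae_lt_top' (hf.enorm.pow_const _).lintegral_prod_right' h2]
    with z hz hz2
  refine MemLp.integrable (q := 2) (by norm_num) ⟨hz, ?_⟩
  rw [eLpNorm_lt_top_iff_lintegral_rpow_enorm_lt_top (by norm_num) (by norm_num)]
  exact hz2

lemma memLp_average (f : L2 (Z × I)) :
    MemLp (fun z => ∫ s : I, f (z, s)) 2 (volume : Measure Z) :=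
  ⟨AEStronglyMeasurable.integral_prod_right'
    (μ := (volume : Measure Z)) (ν := (volume : Measure I)) (Lp.aestronglyMeasurable f),
    (eLpNorm_average_le f).trans_lt (Lp.memLp f).2⟩

/-- Integration over the last variable: `(J f)(z) = ∫₀¹ f(z, s) ds`. -/
def averageOp : L2 (Z × I) →L[ℂ] L2 Z :=
  LinearMap.mkContinuous
    { toFun := fun f => (memLp_average f).toLp _
      map_add' := fun f h => by
        rw [← MemLp.toLp_add, MemLp.toLp_eq_toLp_iff]
        filter_upwards [Measure.ae_ae_of_ae_prod (Lp.coeFn_add f h), ae_integrable_slice f,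
          ae_integrable_slice h] with z hz hf hh
        rw [Pi.add_apply, ← integral_add hf hh]
        exact integral_congr_ae hz
      map_smul' := fun c f => by
        rw [RingHom.id_apply, ← MemLp.toLp_const_smul, MemLp.toLp_eq_toLp_iff]
        filter_upwards [Measure.ae_ae_of_ae_prod (Lp.coeFn_smul c f)] with z hz
        rw [Pi.smul_apply, ← integral_smul]
        exact integral_congr_ae hz }
    1 (fun f => by
      rw [one_mul]
      change ‖(memLp_average f).toLp _‖ ≤ _
      rw [Lp.norm_toLp, Lp.norm_def]
      exact ENNReal.toReal_mono (Lp.memLp f).2.ne (eLpNorm_average_le f))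

lemma averageOp_apply (f : L2 (Z × I)) :
    averageOp f =ᵐ[volume] fun z => ∫ s : I, f (z, s) :=
  (memLp_average f).coeFn_toLp

end Average

section Kernel

variable {Z : Type*} [TopologicalSpace Z] [CompactSpace Z]
  [MeasureSpace Z] [BorelSpace Z]

/-- `(A f)(z) = ∫₀¹ k(z, s) f(φ(z, s)) ds`, where `φ : Z × [0,1] → Z` preserves the measure. -/
def partialIntegralOp (φ : Z × I → Z) (hφ : MeasurePreserving φ) (k : C(Z × I, ℂ)) :
    L2 Z →L[ℂ] L2 Z :=
  averageOp ∘L mulOp k ∘L (Lp.compMeasurePreservingₗᵢ ℂ φ hφ).toContinuousLinearMap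

lemma partialIntegralOp_apply (φ : Z × I → Z) (hφ : MeasurePreserving φ) (k : C(Z × I, ℂ))
    (f : L2 Z) :
    partialIntegralOp φ hφ k f =ᵐ[volume] fun z => ∫ s : I, k (z, s) * f (φ (z, s)) := by
  refine (averageOp_apply _).trans ?_
  have h : mulOp k (Lp.compMeasurePreservingₗᵢ ℂ φ hφ f) =ᵐ[volume] fun p => k p * f (φ p) := by
    filter_upwards [mulOp_apply k (Lp.compMeasurePreservingₗᵢ ℂ φ hφ f),
      Lp.coeFn_compMeasurePreserving f hφ] with p hp hq
    rw [hp]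
    exact congrArg (k p * ·) hq
  filter_upwards [Measure.ae_ae_of_ae_prod h] with z hz
  exact integral_congr_ae hz

end Kernel

/-- The integral operator `(K f)(x) = ∫₀¹ k(x, s) f(s) ds` in `L²[0,1]`. -/
def integralOp (k : C(I × I, ℂ)) : L2 I →L[ℂ] L2 I :=
  partialIntegralOp (fun p => p.2) measurePreserving_snd k

/-- The Friedrichs model `H = U - K` in `L²[0,1]`:
`(H f)(x) = w(x) f(x) - ∫₀¹ k(x, s) f(s) ds`. -/
def friedrichsOp (w : C(I, ℝ)) (k : C(I × I, ℂ)) : L2 I →L[ℂ] L2 I :=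
  mulOp ⟨fun x => (w x : ℂ), by fun_prop⟩ - integralOp k

lemma friedrichsOp_apply (w : C(I, ℝ)) (k : C(I × I, ℂ)) (f : L2 I) :
    friedrichsOp w k f =ᵐ[volume] fun x => w x * f x - ∫ s : I, k (x, s) * f s := by
  filter_upwards [Lp.coeFn_sub (mulOp ⟨fun x => (w x : ℂ), by fun_prop⟩ f) (integralOp k f),
    mulOp_apply ⟨fun x => (w x : ℂ), by fun_prop⟩ f,
    partialIntegralOp_apply (fun p : I × I => p.2) measurePreserving_snd k f] with x h1 h2 h3
  refine h1.trans ?_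
  rw [Pi.sub_apply, h2]
  exact congrArg _ h3

lemma measurePreserving_slot_snd :
    MeasurePreserving (fun p : (I × I) × I => (p.1.1, p.2)) :=
  (measurePreserving_fst (μ := (volume : Measure I)) (ν := (volume : Measure I))).prod
    (MeasurePreserving.id (volume : Measure I))

lemma measurePreserving_slot_fst :
    MeasurePreserving (fun p : (I × I) × I => (p.2, p.1.2)) :=
  (Measure.measurePreserving_swap (μ := (volume : Measure I)) (ν := (volume : Measure I))).comp
    ((measurePreserving_snd (μ := (volume : Measure I)) (ν := (volume : Measure I))).prod
      (MeasurePreserving.id (volume : Measure I)))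

/-- `(T₀ f)(x, y) = (u(x) + v(y)) f(x, y)` in `L²([0,1]²)`. -/
def freeOp (u v : C(I, ℝ)) : L2 (I × I) →L[ℂ] L2 (I × I) :=
  mulOp ⟨fun p => ((u p.1 + v p.2 : ℝ) : ℂ), by fun_prop⟩

/-- `(T₁ f)(x, y) = ∫₀¹ k₁(x, s) f(s, y) ds` in `L²([0,1]²)`. -/
def interactionOp₁ (k₁ : C(I × I, ℂ)) : L2 (I × I) →L[ℂ] L2 (I × I) :=
  partialIntegralOp (fun p => (p.2, p.1.2)) measurePreserving_slot_fst
    ⟨fun p => k₁ (p.1.1, p.2), by fun_prop⟩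

/-- `(T₂ f)(x, y) = ∫₀¹ k₂(y, t) f(x, t) dt` in `L²([0,1]²)`. -/
def interactionOp₂ (k₂ : C(I × I, ℂ)) : L2 (I × I) →L[ℂ] L2 (I × I) :=
  partialIntegralOp (fun p => (p.1.1, p.2)) measurePreserving_slot_snd
    ⟨fun p => k₂ (p.1.2, p.2), by fun_prop⟩

/-- The "three-particle" discrete Schrödinger operator `T = T₀ - (T₁ + T₂)`. -/
def threeParticleOp (u v : C(I, ℝ)) (k₁ k₂ : C(I × I, ℂ)) : L2 (I × I) →L[ℂ] L2 (I × I) :=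
  freeOp u v - (interactionOp₁ k₁ + interactionOp₂ k₂)

lemma interactionOp₁_apply (k₁ : C(I × I, ℂ)) (f : L2 (I × I)) :
    interactionOp₁ k₁ f =ᵐ[volume] fun p => ∫ s : I, k₁ (p.1, s) * f (s, p.2) :=
  partialIntegralOp_apply _ measurePreserving_slot_fst _ f

lemma interactionOp₂_apply (k₂ : C(I × I, ℂ)) (f : L2 (I × I)) :
    interactionOp₂ k₂ f =ᵐ[volume] fun p => ∫ t : I, k₂ (p.2, t) * f (p.1, t) :=
  partialIntegralOp_apply _ measurePreserving_slot_snd _ f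

end

end Efimov

/-! Under `L²([0,1]²) = L²[0,1] ⊗ L²[0,1]` the operator is `T = H₁ ⊗ 1 + 1 ⊗ H₂`, so `φ ⊗ ψ` is an
eigenvector for `α + β` whenever `φ`, `ψ` are eigenvectors for `α`, `β`. By Weyl's criterion
`σ_e(H₂)` is the range of `v`, an interval `[0, max v]`, and `K₂ ≥ 0` excludes eigenvalues above it.
Hence the infinite set `σ_d(H₂)` is negative and accumulates only at `0`, which gives `α + βₙ → α`
from the left.

The remaining point is that `α` is isolated from the left in `σ_e(T)`. Choose `ε` with `α < -2ε`.
Below `-2ε` the set `σ_e(T)` lies in finitely many intervals `aᵢ + range v` and `bⱼ + range u`,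
where `aᵢ, bⱼ ≤ -ε` are eigenvalues of `H₁`, `H₂` (`isSemiFredholmAt_add`); conversely these
intervals lie in `σ_e(T)` (`isSemiFredholmAt_right`). An interval starting at or after `α` has no
points left of `α`; one starting before `α` cannot contain `α`, since `α` is the left endpoint of
its component, so by closedness it misses a neighbourhood of `α`.

The essential spectrum is handled throughout as failure of a lower bound for `A - x` on a subspace
of finite codimension (`mem_essentialSpectrum_iff`). -/

namespace Efimov

/-! ### Weyl's criterion and spectral projections at isolated points. -/

section SemiFredholm

variable {E : Type*} [NormedAddCommGroup E] [InnerProductSpace ℂ E]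

/-- `A - x` is bounded from below on a subspace of finite codimension. -/
def IsSemiFredholmAt (A : E →L[ℂ] E) (x : ℝ) : Prop :=
  ∃ V : Submodule ℂ E, FiniteDimensional ℂ V ∧ ∃ c > 0, ∀ f ∈ Vᗮ, c * ‖f‖ ≤ ‖A f - (x : ℂ) • f‖

lemma algebraMap_sub_apply (A : E →L[ℂ] E) (x : ℝ) (f : E) :
    (algebraMap ℝ (E →L[ℂ] E) x - A) f = (x : ℂ) • f - A f := by
  rw [Algebra.algebraMap_eq_smul_one]
  simp

lemma isEigenvalue_iff {A : E →L[ℂ] E} {x : ℝ} :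
    IsEigenvalue A x ↔ ∃ f, f ≠ 0 ∧ A f = (x : ℂ) • f := by
  constructor
  · intro h
    obtain ⟨f, hf⟩ := h.exists_hasEigenvector
    exact ⟨f, hf.2, hf.apply_eq_smul⟩
  · rintro ⟨f, hf, h⟩
    exact Module.End.hasEigenvalue_of_hasEigenvector
      (Module.End.hasEigenvector_iff.2 ⟨Module.End.mem_eigenspace_iff.2 h, hf⟩)

lemma IsEigenvalue.mem_spectrum {A : E →L[ℂ] E} {x : ℝ} (h : IsEigenvalue A x) :
    x ∈ spectrum ℝ A := by
  obtain ⟨f, hf, h⟩ := isEigenvalue_iff.1 h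
  rw [spectrum.mem_iff]
  rintro ⟨B, hB⟩
  apply hf
  have h1 : (↑B⁻¹ : E →L[ℂ] E) ((B : E →L[ℂ] E) f) = f := by
    rw [← _root_.mul_apply_eq_comp, Units.inv_mul]; rfl
  rw [← h1, hB, algebraMap_sub_apply, h, sub_self, map_zero]

lemma multiplicity_lt_top_iff {A : E →L[ℂ] E} {x : ℝ} :
    multiplicity A x < ⊤ ↔
      FiniteDimensional ℂ (Module.End.eigenspace (A : E →ₗ[ℂ] E) (x : ℂ)) := by
  rw [multiplicity, Cardinal.toENat_lt_top]
  exact Module.rank_lt_aleph0_iff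

lemma multiplicity_eq_zero_iff {A : E →L[ℂ] E} {x : ℝ} :
    multiplicity A x = 0 ↔ ¬ IsEigenvalue A x := by
  rw [multiplicity, Cardinal.toENat_eq_zero, Submodule.rank_eq_zero, IsEigenvalue,
    Module.End.hasEigenvalue_iff, not_not]

lemma exists_bound_of_notMem_spectrum {A : E →L[ℂ] E} {x : ℝ} (h : x ∉ spectrum ℝ A) :
    ∃ c > 0, ∀ f, c * ‖f‖ ≤ ‖A f - (x : ℂ) • f‖ := by
  rw [spectrum.notMem_iff] at h
  obtain ⟨B, hB⟩ := h
  set R : E →L[ℂ] E := ↑B⁻¹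
  refine ⟨(‖R‖ + 1)⁻¹, by positivity, fun f => ?_⟩
  have h1 : R ((B : E →L[ℂ] E) f) = f := by
    rw [← _root_.mul_apply_eq_comp, Units.inv_mul]; rfl
  rw [hB, algebraMap_sub_apply] at h1
  rw [inv_mul_le_iff₀ (by positivity), norm_sub_rev]
  calc ‖f‖ = ‖R ((x : ℂ) • f - A f)‖ := by rw [h1]
    _ ≤ ‖R‖ * ‖(x : ℂ) • f - A f‖ := R.le_opNorm _
    _ ≤ _ := by gcongr; linarith

lemma isSemiFredholmAt_of_notMem_spectrum {A : E →L[ℂ] E} {x : ℝ} (h : x ∉ spectrum ℝ A) :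
    IsSemiFredholmAt A x := by
  obtain ⟨c, hc, h⟩ := exists_bound_of_notMem_spectrum h
  exact ⟨⊥, inferInstance, c, hc, fun f _ => h f⟩

/-- The projection onto `V` is injective on the eigenspace, because the lower bound kills every
eigenvector in `Vᗮ`. -/
lemma IsSemiFredholmAt.finiteDimensional_eigenspace {A : E →L[ℂ] E} {x : ℝ}
    (h : IsSemiFredholmAt A x) :
    FiniteDimensional ℂ (Module.End.eigenspace (A : E →ₗ[ℂ] E) (x : ℂ)) := by
  obtain ⟨V, hV, c, hc, h⟩ := h
  let L : Module.End.eigenspace (A : E →ₗ[ℂ] E) (x : ℂ) →ₗ[ℂ] V :=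
    (V.orthogonalProjectionOnto : E →ₗ[ℂ] V) ∘ₗ Submodule.subtype _
  refine FiniteDimensional.of_injective L ((injective_iff_map_eq_zero L).2 ?_)
  rintro ⟨f, hf⟩ hf0
  have h1 : f ∈ Vᗮ := Submodule.orthogonalProjectionOnto_eq_zero_iff.1 hf0
  have h2 := h f h1
  have h3 : A f = (x : ℂ) • f := Module.End.mem_eigenspace_iff.1 hf
  rw [h3, sub_self, norm_zero] at h2
  exact Subtype.ext (norm_le_zero_iff.1 (nonpos_of_mul_nonpos_right h2 hc))

variable [CompleteSpace E] {A : E →L[ℂ] E} {x : ℝ}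

lemma inner_sub_smul (hA : IsSelfAdjoint A) (f g : E) :
    inner ℂ (A f - (x : ℂ) • f) g = inner ℂ f (A g - (x : ℂ) • g) := by
  rw [inner_sub_left, inner_sub_right, inner_smul_left, inner_smul_right, Complex.conj_ofReal]
  congr 1
  exact hA.isSymmetric f g

/-- The lower bound gives injectivity and closed range; self-adjointness makes the orthogonal
complement of the range the kernel, so the range is also dense. -/
lemma notMem_spectrum_of_bound (hA : IsSelfAdjoint A)
    (h : ∃ c > 0, ∀ f, c * ‖f‖ ≤ ‖A f - (x : ℂ) • f‖) : x ∉ spectrum ℝ A := by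
  obtain ⟨c, hc, h⟩ := h
  rw [spectrum.notMem_iff, ContinuousLinearMap.isUnit_iff_bijective,
    ContinuousLinearMap.bijective_iff_dense_range_and_antilipschitz]
  constructor
  · rw [Submodule.topologicalClosure_eq_top_iff, Submodule.eq_bot_iff]
    intro f hf
    have h1 : A f - (x : ℂ) • f = 0 := by
      refine ext_inner_left ℂ fun g => ?_
      rw [inner_zero_right, ← inner_sub_smul hA, ← neg_sub, inner_neg_left, neg_eq_zero]
      exact hf _ ⟨g, algebraMap_sub_apply A x g⟩
    have h2 := h f
    rw [h1, norm_zero] at h2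
    exact norm_le_zero_iff.1 (nonpos_of_mul_nonpos_right h2 hc)
  · refine ⟨_, ContinuousLinearMap.antilipschitz_of_bound _ (K := ⟨c⁻¹, by positivity⟩)
      fun f => ?_⟩
    rw [algebraMap_sub_apply, norm_sub_rev]
    change _ ≤ c⁻¹ * _
    rw [le_inv_mul_iff₀ hc]
    exact h f

/-- `A - x` is bounded from below on the orthogonal complement of its kernel. -/
lemma IsSemiFredholmAt.exists_bound (h : IsSemiFredholmAt A x) :
    ∃ c > 0, ∀ f ∈ (Module.End.eigenspace (A : E →ₗ[ℂ] E) (x : ℂ))ᗮ,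
      c * ‖f‖ ≤ ‖A f - (x : ℂ) • f‖ := by
  set N := Module.End.eigenspace (A : E →ₗ[ℂ] E) (x : ℂ)
  obtain ⟨V, hV, c, hc, h⟩ := h
  by_contra! hcon
  -- Otherwise there are unit vectors `fₙ ∈ Nᗮ` with `(A - x) fₙ → 0`. Along a subsequence their
  -- `V`-components converge by compactness, and their `Vᗮ`-components are then Cauchy by the bound
  -- on `Vᗮ`. The limit is a unit vector in `N ∩ Nᗮ`.
  have key : ∀ n : ℕ, ∃ f ∈ Nᗮ, ‖f‖ = 1 ∧ ‖A f - (x : ℂ) • f‖ < 1 / ((n : ℝ) + 1) := by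
    intro n
    obtain ⟨f, hf, hlt⟩ := hcon (1 / ((n : ℝ) + 1)) (by positivity)
    have hf0 : ‖f‖ ≠ 0 := by
      intro h0
      rw [h0, mul_zero] at hlt
      exact absurd hlt (not_lt.2 (norm_nonneg _))
    have hpos : 0 < ‖f‖ := lt_of_le_of_ne (norm_nonneg _) hf0.symm
    refine ⟨((‖f‖⁻¹ : ℝ) : ℂ) • f, Submodule.smul_mem _ _ hf, ?_, ?_⟩
    · rw [norm_smul, Complex.norm_real, norm_inv, norm_norm, inv_mul_cancel₀ hf0]
    · rw [map_smul, smul_comm, ← smul_sub, norm_smul, Complex.norm_real, norm_inv, norm_norm,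
        inv_mul_lt_iff₀ hpos, mul_comm]
      exact hlt
  choose f hfN hf1 hfA using key
  let B : E →L[ℂ] E := A - (x : ℂ) • ContinuousLinearMap.id ℂ E
  have hB : ∀ g, B g = A g - (x : ℂ) • g := fun g => rfl
  have hBlim : Tendsto (fun n => B (f n)) atTop (𝓝 0) :=
    squeeze_zero_norm (fun n => (hfA n).le) tendsto_one_div_add_atTop_nhds_zero_nat
  have hcpt : IsCompact (Metric.closedBall (0 : V) 1) := isCompact_closedBall _ _
  obtain ⟨a, -, φ, hφ, hlim⟩ := hcpt.tendsto_subseq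
    (x := fun n => V.orthogonalProjectionOnto (f n)) (fun n => by
      rw [mem_closedBall_zero_iff]
      exact (V.norm_orthogonalProjectionOnto_apply_le (f n)).trans (hf1 n).le)
  let q : ℕ → E := fun n => f (φ n) - V.orthogonalProjectionOnto (f (φ n))
  have hqV : ∀ n, q n ∈ Vᗮ := fun n => V.sub_starProjection_mem_orthogonal _
  have hlim' : Tendsto (fun n => (V.orthogonalProjectionOnto (f (φ n)) : E)) atTop (𝓝 a) :=
    (continuous_subtype_val.tendsto a).comp hlim
  have hBq : Tendsto (fun n => B (q n)) atTop (𝓝 (0 - B a)) := by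
    simp only [q, map_sub]
    exact (hBlim.comp hφ.tendsto_atTop).sub ((B.continuous.tendsto _).comp hlim')
  have hq : CauchySeq q := by
    have hC := hBq.cauchySeq
    rw [Metric.cauchySeq_iff] at hC ⊢
    intro ε hε
    obtain ⟨M, hM⟩ := hC (c * ε) (by positivity)
    refine ⟨M, fun m hm n hn => ?_⟩
    have h1 := h _ (Submodule.sub_mem _ (hqV m) (hqV n))
    rw [← hB, map_sub, ← dist_eq_norm, ← dist_eq_norm] at h1
    exact lt_of_mul_lt_mul_left (h1.trans_lt (hM m hm n hn)) hc.le
  obtain ⟨b, hb⟩ := cauchySeq_tendsto_of_complete hq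
  have hf : Tendsto (fun n => f (φ n)) atTop (𝓝 (b + a)) := by
    refine (hb.add hlim').congr fun n => ?_
    simp [q]
  have h1 : ‖b + a‖ = 1 := tendsto_nhds_unique hf.norm (by simp [hf1])
  have h2 : B (b + a) = 0 := tendsto_nhds_unique ((B.continuous.tendsto _).comp hf)
    (hBlim.comp hφ.tendsto_atTop)
  have h3 : b + a ∈ N := Module.End.mem_eigenspace_iff.2 (sub_eq_zero.1 h2)
  have h4 : b + a ∈ Nᗮ := N.isClosed_orthogonal.mem_of_tendsto hf
    (Eventually.of_forall fun n => hfN _)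
  have h5 : b + a = 0 := inner_self_eq_zero (𝕜 := ℂ).1 (h4 _ h3)
  rw [h5, norm_zero] at h1
  exact zero_ne_one h1

/-- `A` respects the splitting `N ⊕ Nᗮ`. For `0 < |y - x| < c`, `A - y` has size `|y - x|` on `N`
and is at least `c - |y - x|` on `Nᗮ`, so `y` is not in the spectrum. If `N` were zero, the same
bound would exclude `x` itself. -/
lemma IsSemiFredholmAt.mem_discreteSpectrum (hA : IsSelfAdjoint A) (h : IsSemiFredholmAt A x)
    (hx : x ∈ spectrum ℝ A) : x ∈ discreteSpectrum A := by
  have hfin := h.finiteDimensional_eigenspace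
  obtain ⟨c, hc, hb⟩ := h.exists_bound
  set N := Module.End.eigenspace (A : E →ₗ[ℂ] E) (x : ℂ) with hN
  refine ⟨hx, ⟨c, hc, ?_⟩, ?_, multiplicity_lt_top_iff.2 hfin⟩
  · refine Set.eq_singleton_iff_unique_mem.2 ⟨⟨⟨by linarith, by linarith⟩, hx⟩, ?_⟩
    rintro y ⟨⟨hy1, hy2⟩, hy⟩
    by_contra hne
    have hd : |y - x| < c := abs_sub_lt_iff.2 ⟨by linarith, by linarith⟩
    have hd0 : 0 < |y - x| := abs_pos.2 (sub_ne_zero.2 hne)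
    refine notMem_spectrum_of_bound hA
      ⟨min |y - x| (c - |y - x|), lt_min hd0 (by linarith), fun f => ?_⟩ hy
    set m := min |y - x| (c - |y - x|)
    have hm0 : 0 < m := lt_min hd0 (by linarith)
    set a := N.starProjection f with ha
    set b := f - a with hbdef
    have haN : a ∈ N := N.starProjection_apply_mem f
    have hbN : b ∈ Nᗮ := N.sub_starProjection_mem_orthogonal f
    have hab : f = a + b := by simp [b]
    have hAa : A a = (x : ℂ) • a := Module.End.mem_eigenspace_iff.1 haN
    have hAb : A b - (y : ℂ) • b ∈ Nᗮ := by
      intro g hg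
      have hAg : A g = (x : ℂ) • g := Module.End.mem_eigenspace_iff.1 hg
      rw [← inner_sub_smul hA, hAg, ← sub_smul, inner_smul_left, hbN g hg, mul_zero]
    have e : A f - (y : ℂ) • f = ((x - y : ℝ) : ℂ) • a + (A b - (y : ℂ) • b) := by
      rw [hab, map_add, hAa, smul_add]
      push_cast
      rw [sub_smul]
      abel
    have o1 : ‖f‖ ^ 2 = ‖a‖ ^ 2 + ‖b‖ ^ 2 := by
      rw [hab, sq, sq, sq]
      exact norm_add_sq_eq_norm_sq_add_norm_sq_of_inner_eq_zero (𝕜 := ℂ) a b (hbN a haN)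
    have o2 : ‖A f - (y : ℂ) • f‖ ^ 2 = (|y - x| * ‖a‖) ^ 2 + ‖A b - (y : ℂ) • b‖ ^ 2 := by
      have : ‖((x - y : ℝ) : ℂ) • a‖ = |y - x| * ‖a‖ := by
        rw [norm_smul, Complex.norm_real, Real.norm_eq_abs, abs_sub_comm]
      rw [← this, e, sq, sq, sq]
      exact norm_add_sq_eq_norm_sq_add_norm_sq_of_inner_eq_zero (𝕜 := ℂ) _ _
        (hAb _ (Submodule.smul_mem _ _ haN))
    have hb2 : m * ‖b‖ ≤ ‖A b - (y : ℂ) • b‖ := by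
      have h1 := hb b hbN
      have h2 : ‖A b - (x : ℂ) • b‖ ≤ ‖A b - (y : ℂ) • b‖ + |y - x| * ‖b‖ := by
        have : A b - (x : ℂ) • b = (A b - (y : ℂ) • b) + ((y - x : ℝ) : ℂ) • b := by
          push_cast
          rw [sub_smul]
          abel
        rw [this]
        refine (norm_add_le _ _).trans_eq ?_
        rw [norm_smul, Complex.norm_real, Real.norm_eq_abs]
      have h3 : m * ‖b‖ ≤ (c - |y - x|) * ‖b‖ := by gcongr; exact min_le_right _ _
      linarith
    have ha2 : m * ‖a‖ ≤ |y - x| * ‖a‖ := by gcongr; exact min_le_left _ _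
    refine le_of_sq_le_sq ?_ (norm_nonneg _)
    rw [mul_pow, o1, o2, mul_add, ← mul_pow, ← mul_pow]
    gcongr
  · rw [IsEigenvalue, Module.End.hasEigenvalue_iff]
    intro h0
    refine notMem_spectrum_of_bound hA ⟨c, hc, fun f => hb f ?_⟩ hx
    rw [hN, h0, Submodule.bot_orthogonal_eq_top]
    trivial

/-- The spectral projection of an isolated point of the spectrum. -/
noncomputable def pointProjection (A : E →L[ℂ] E) (x : ℝ) : E →L[ℂ] E :=
  cfc (fun t : ℝ => if t = x then (1 : ℝ) else 0) A

/-- At an isolated point continuity is automatic, so the functional calculus applies both to the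
indicator of `x` and to `(t - x)⁻¹` with its value at `x` replaced. -/
lemma continuousOn_of_isolated {S : Set ℝ} (hx : ∃ ε > 0, Set.Ioo (x - ε) (x + ε) ∩ S = {x})
    (g h : ℝ → ℝ) (hh : ContinuousOn h {x}ᶜ) :
    ContinuousOn (fun t => if t = x then g t else h t) S := by
  obtain ⟨ε, hε, hS⟩ := hx
  intro t ht
  by_cases htx : t = x
  · subst htx
    refine (continuousWithinAt_const (b := g t)).congr_of_eventuallyEq ?_ (by simp)
    have : Set.Ioo (t - ε) (t + ε) ∩ S ∈ 𝓝[S] t := by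
      rw [Set.inter_comm]
      exact inter_mem_nhdsWithin _ (Ioo_mem_nhds (by linarith) (by linarith))
    filter_upwards [this] with s hs
    rw [hS] at hs
    simp [Set.mem_singleton_iff.1 hs]
  · have hc : ContinuousAt h t := hh.continuousAt (isOpen_compl_singleton.mem_nhds htx)
    refine (hc.congr ?_).continuousWithinAt
    filter_upwards [isOpen_compl_singleton.mem_nhds htx] with s hs
    exact (if_neg hs).symm

lemma continuousOn_indicator_of_isolated {S : Set ℝ}
    (hx : ∃ ε > 0, Set.Ioo (x - ε) (x + ε) ∩ S = {x}) :
    ContinuousOn (fun t : ℝ => if t = x then (1 : ℝ) else 0) S :=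
  continuousOn_of_isolated hx (fun _ => 1) (fun _ => 0) continuousOn_const

lemma isSelfAdjoint_pointProjection : IsSelfAdjoint (pointProjection A x) :=
  cfc_predicate _ _

lemma pointProjection_mem (hA : IsSelfAdjoint A)
    (hx : ∃ ε > 0, Set.Ioo (x - ε) (x + ε) ∩ spectrum ℝ A = {x}) (f : E) :
    pointProjection A x f ∈ Module.End.eigenspace (A : E →ₗ[ℂ] E) (x : ℂ) := by
  have hc := continuousOn_indicator_of_isolated hx
  have h1 : A * pointProjection A x = x • pointProjection A x := by
    nth_rewrite 1 [← cfc_id' ℝ A]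
    rw [pointProjection, ← cfc_mul _ _ A (continuousOn_id' _) hc, ← cfc_smul x _ A hc]
    refine cfc_congr fun t _ => ?_
    by_cases h : t = x <;> simp [h]
  rw [Module.End.mem_eigenspace_iff]
  have h2 := DFunLike.congr_fun h1 f
  simpa using h2

lemma pointProjection_mul_self
    (hx : ∃ ε > 0, Set.Ioo (x - ε) (x + ε) ∩ spectrum ℝ A = {x}) :
    pointProjection A x * pointProjection A x = pointProjection A x := by
  have hc := continuousOn_indicator_of_isolated hx
  rw [pointProjection, ← cfc_mul _ _ A hc hc]
  exact cfc_congr fun t _ => by by_cases h : t = x <;> simp [h]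

/-- The reduced resolvent `R`, given by `(t - x)⁻¹` off `x` and `0` at `x`, satisfies `R (A - x) + P
= 1` with `P` the spectral projection. Since `P` vanishes on `Nᗮ`, there `f = R (A - x) f`, and
`‖R‖` yields the lower bound. -/
lemma isSemiFredholmAt_of_mem_discreteSpectrum (hA : IsSelfAdjoint A)
    (hx : x ∈ discreteSpectrum A) : IsSemiFredholmAt A x := by
  obtain ⟨-, hiso, -, hmul⟩ := hx
  have hc := continuousOn_indicator_of_isolated hiso
  have hfin := multiplicity_lt_top_iff.1 hmul
  set N := Module.End.eigenspace (A : E →ₗ[ℂ] E) (x : ℂ)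
  have hc2 : ContinuousOn (fun t : ℝ => if t = x then (0 : ℝ) else (t - x)⁻¹) (spectrum ℝ A) :=
    continuousOn_of_isolated hiso (fun _ => 0) (fun t => (t - x)⁻¹)
      (ContinuousOn.inv₀ (by fun_prop) fun t ht => sub_ne_zero.2 ht)
  set R : E →L[ℂ] E := cfc (fun t : ℝ => if t = x then (0 : ℝ) else (t - x)⁻¹) A
  have h1 : R * (A - algebraMap ℝ _ x) + pointProjection A x = 1 := by
    have e : A - algebraMap ℝ _ x = cfc (fun t : ℝ => t - x) A := by
      rw [cfc_sub (fun t : ℝ => t) (fun _ => x) A, cfc_id' ℝ A, cfc_const x A]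
    rw [e, pointProjection, ← cfc_mul _ _ A hc2 (by fun_prop),
      ← cfc_add A (fun t => (if t = x then (0 : ℝ) else (t - x)⁻¹) * (t - x)) _
        (hc2.mul (by fun_prop)) hc, ← cfc_one ℝ A]
    refine cfc_congr fun t _ => ?_
    by_cases h : t = x
    · simp [h]
    · simp [h, inv_mul_cancel₀ (sub_ne_zero.2 h)]
  refine ⟨N, hfin, (‖R‖ + 1)⁻¹, by positivity, fun f hf => ?_⟩
  have hP : pointProjection A x f = 0 := by
    refine ext_inner_left ℂ fun g => ?_
    rw [inner_zero_right]
    have := isSelfAdjoint_pointProjection (A := A) (x := x) |>.isSymmetric g f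
    rw [ContinuousLinearMap.coe_coe] at this
    rw [← this]
    exact hf _ (pointProjection_mem hA hiso g)
  have h2 : R (A f - (x : ℂ) • f) = f := by
    have := DFunLike.congr_fun h1 f
    rw [_root_.add_apply, hP, add_zero, _root_.mul_apply_eq_comp,
      ← neg_sub, _root_.neg_apply, algebraMap_sub_apply, neg_sub] at this
    exact this
  rw [inv_mul_le_iff₀ (by positivity)]
  calc ‖f‖ = ‖R (A f - (x : ℂ) • f)‖ := by rw [h2]
    _ ≤ ‖R‖ * ‖A f - (x : ℂ) • f‖ := R.le_opNorm _
    _ ≤ _ := by gcongr; linarith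

/-- Weyl's criterion for the essential spectrum. -/
lemma mem_essentialSpectrum_iff (hA : IsSelfAdjoint A) :
    x ∈ essentialSpectrum A ↔ ¬ IsSemiFredholmAt A x := by
  constructor
  · rintro ⟨h1, h2⟩ h
    exact h2 (h.mem_discreteSpectrum hA h1)
  · intro h
    exact ⟨by_contra fun h1 => h (isSemiFredholmAt_of_notMem_spectrum h1),
      fun h2 => h (isSemiFredholmAt_of_mem_discreteSpectrum hA h2)⟩

/-- This part of the spectrum is compact, and each of its points is isolated. -/
lemma finite_spectrum_inter_Iic (hA : IsSelfAdjoint A) {r : ℝ}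
    (h : ∀ x ≤ r, IsSemiFredholmAt A x) : (spectrum ℝ A ∩ Set.Iic r).Finite := by
  refine ((spectrum.isCompact A).inter_right isClosed_Iic).finite ?_
  rw [isDiscrete_iff_discreteTopology, discreteTopology_subtype_iff']
  rintro y ⟨hy, hyr⟩
  obtain ⟨-, ⟨ε, hε, h1⟩, -⟩ := (h y hyr).mem_discreteSpectrum hA hy
  refine ⟨Set.Ioo (y - ε) (y + ε), isOpen_Ioo, ?_⟩
  rw [← Set.inter_assoc, h1]
  exact Set.inter_eq_left.2 (Set.singleton_subset_iff.2 hyr)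

/-- The spectral projection `P` is self-adjoint and idempotent with range in the eigenspace, so `⟨P
f, f⟩ = ‖P f‖²`, and only the eigenspace component of `f` pairs with `P f`. The inequality suffices;
`P` need not be identified with the orthogonal projection. -/
lemma re_inner_pointProjection_le (hA : IsSelfAdjoint A)
    (hx : ∃ ε > 0, Set.Ioo (x - ε) (x + ε) ∩ spectrum ℝ A = {x}) {ι : Type*} [Fintype ι]
    (b : OrthonormalBasis ι ℂ (Module.End.eigenspace (A : E →ₗ[ℂ] E) (x : ℂ))) (f : E) :
    (inner ℂ (pointProjection A x f) f).re ≤ ∑ i, ‖inner ℂ (b i : E) f‖ ^ 2 := by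
  let N := Module.End.eigenspace (A : E →ₗ[ℂ] E) (x : ℂ)
  have : FiniteDimensional ℂ N := b.toBasis.finiteDimensional_of_finite
  set g := pointProjection A x f with hg
  have hgN : g ∈ N := pointProjection_mem hA hx f
  have h1 : inner ℂ g f = inner ℂ g g := by
    have h2 : pointProjection A x g = g :=
      DFunLike.congr_fun (pointProjection_mul_self (A := A) hx) f
    have h3 := isSelfAdjoint_pointProjection (A := A) (x := x) |>.isSymmetric g f
    rw [ContinuousLinearMap.coe_coe, h2] at h3
    exact h3
  have h2 : (inner ℂ g f).re = ‖g‖ ^ 2 := by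
    rw [h1]
    exact inner_self_eq_norm_sq (𝕜 := ℂ) g
  have h3 : ‖g‖ ^ 2 ≤ ‖g‖ * ‖N.orthogonalProjectionOnto f‖ := by
    rw [← h2]
    refine (Complex.re_le_norm _).trans ?_
    have : inner ℂ g f = inner ℂ (⟨g, hgN⟩ : N) (N.orthogonalProjectionOnto f) :=
      (N.inner_orthogonalProjectionOnto_eq_of_mem_left ⟨g, hgN⟩ f).symm
    rw [this]
    exact norm_inner_le_norm _ _
  have h4 : ‖N.orthogonalProjectionOnto f‖ ^ 2 = ∑ i, ‖inner ℂ (b i : E) f‖ ^ 2 := by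
    rw [← b.sum_sq_norm_inner_right]
    exact Finset.sum_congr rfl fun i _ => by
      rw [N.inner_orthogonalProjectionOnto_eq_of_mem_left]
  rw [h2, ← h4]
  nlinarith [norm_nonneg g, norm_nonneg (N.orthogonalProjectionOnto f)]

/-- Up to `ε`, the negative part of `A` is bounded by finitely many eigenvectors. -/
lemma exists_eigenvectors_of_isSemiFredholmAt (hA : IsSelfAdjoint A)
    (h : ∀ x < 0, IsSemiFredholmAt A x) {ε : ℝ} (hε : 0 < ε) :
    ∃ (ι : Type) (_ : Fintype ι) (φ : ι → E) (a : ι → ℝ) (C : ℝ),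
      (∀ i, ‖φ i‖ = 1) ∧ (∀ i, A (φ i) = (a i : ℂ) • φ i) ∧ 0 ≤ C ∧
      ∀ f, 0 ≤ (inner ℂ (A f) f).re + ε * ‖f‖ ^ 2 + C * ∑ i, ‖inner ℂ (φ i) f‖ ^ 2 := by
  have hfinS := finite_spectrum_inter_Iic hA (r := -ε) fun x hx => h x (by linarith)
  have hd : ∀ s ∈ hfinS.toFinset, s ∈ discreteSpectrum A := fun s hs => by
    obtain ⟨h1, h2⟩ := hfinS.mem_toFinset.1 hs
    exact (h s (by rw [Set.mem_Iic] at h2; linarith)).mem_discreteSpectrum hA h1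
  have hfd : ∀ s : hfinS.toFinset,
      FiniteDimensional ℂ (Module.End.eigenspace (A : E →ₗ[ℂ] E) ((s : ℝ) : ℂ)) :=
    fun s => multiplicity_lt_top_iff.1 (hd s s.2).2.2.2
  let b := fun s : hfinS.toFinset =>
    stdOrthonormalBasis ℂ (Module.End.eigenspace (A : E →ₗ[ℂ] E) ((s : ℝ) : ℂ))
  refine ⟨Σ s : hfinS.toFinset, Fin (Module.finrank ℂ (Module.End.eigenspace
      (A : E →ₗ[ℂ] E) ((s : ℝ) : ℂ))), inferInstance,
    fun i => b i.1 i.2, fun i => i.1, ‖A‖, fun i => ?_, fun i => ?_, norm_nonneg _, fun f => ?_⟩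
  · exact (b _).orthonormal.1 i.2
  · exact Module.End.mem_eigenspace_iff.1 (b _ i.2).2
  · have hc : ∀ s ∈ hfinS.toFinset,
        ContinuousOn (fun t : ℝ => if t = s then (1 : ℝ) else 0) (spectrum ℝ A) :=
      fun s hs => continuousOn_indicator_of_isolated (hd s hs).2.1
    -- By functional calculus: at spectral points `t ≤ -ε` exactly one indicator equals `1` and `t ≥
    -- -‖A‖`, so `C = ‖A‖` compensates; at all other points `t + ε > 0` already.
    have hpos : 0 ≤ A + algebraMap ℝ _ ε + ‖A‖ • ∑ s ∈ hfinS.toFinset, pointProjection A s := by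
      have e : A + algebraMap ℝ _ ε + ‖A‖ • ∑ s ∈ hfinS.toFinset, pointProjection A s =
          cfc (fun t : ℝ => t + ε + ‖A‖ • ∑ s ∈ hfinS.toFinset, if t = s then (1 : ℝ) else 0) A := by
        have hcs : ContinuousOn (fun t : ℝ => ∑ s ∈ hfinS.toFinset, if t = s then (1 : ℝ) else 0)
          (spectrum ℝ A) := continuousOn_finsetSum _ hc
        rw [cfc_add A (fun t : ℝ => t + ε)
            (fun t => ‖A‖ • ∑ s ∈ hfinS.toFinset, if t = s then (1 : ℝ) else 0)
            (by fun_prop) (hcs.const_smul ‖A‖),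
          cfc_add A (fun t : ℝ => t) (fun _ => ε), cfc_id' ℝ A, cfc_const ε A,
          cfc_smul ‖A‖ _ A hcs]
        simp only [pointProjection]
        rw [← cfc_sum _ A _ hc]
        congr 3
        ext t
        simp
      rw [e]
      refine cfc_nonneg fun t ht => ?_
      have h0 : 0 ≤ ∑ s ∈ hfinS.toFinset, (if t = s then (1 : ℝ) else 0) :=
        Finset.sum_nonneg fun s _ => by split_ifs <;> norm_num
      by_cases hts : t ≤ -ε
      · have h1 : ∑ s ∈ hfinS.toFinset, (if t = s then (1 : ℝ) else 0) = 1 := by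
          rw [Finset.sum_ite_eq, if_pos (hfinS.mem_toFinset.2 ⟨ht, hts⟩)]
        have h2 : -‖A‖ ≤ t := by
          have : Nontrivial E := by
            by_contra hE
            rw [not_nontrivial_iff_subsingleton] at hE
            simp at ht
          have := spectrum.norm_le_norm_of_mem ht
          exact (abs_le.1 this).1
        rw [h1, smul_eq_mul]
        linarith
      · have := smul_nonneg (norm_nonneg A) h0
        linarith
    rw [ContinuousLinearMap.nonneg_iff_isPositive] at hpos
    have h1 := hpos.re_inner_nonneg_left f
    have h2 : (inner ℂ ((A + algebraMap ℝ _ ε + ‖A‖ • ∑ s ∈ hfinS.toFinset,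
        pointProjection A s) f) f).re = (inner ℂ (A f) f).re + ε * ‖f‖ ^ 2 +
        ‖A‖ * ∑ s ∈ hfinS.toFinset, (inner ℂ (pointProjection A s f) f).re := by
      have key : ∀ (r : ℝ) (g : E), (inner ℂ (r • g) f).re = r * (inner ℂ g f).re := fun r g => by
        rw [RCLike.real_smul_eq_coe_smul (K := ℂ), inner_smul_left]
        simp
      rw [Algebra.algebraMap_eq_smul_one]
      simp only [_root_.add_apply, _root_.smul_apply, _root_.one_apply_eq_self, inner_add_left,
        Complex.add_re, key, _root_.sum_apply, sum_inner, Complex.re_sum]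
      congr 3
      exact inner_self_eq_norm_sq (𝕜 := ℂ) f
    change 0 ≤ (inner ℂ _ f).re at h1
    rw [h2] at h1
    refine h1.trans ?_
    gcongr
    rw [Fintype.sum_sigma, ← Finset.sum_coe_sort]
    exact Finset.sum_le_sum fun s _ => re_inner_pointProjection_le hA (hd s s.2).2.1 (b s) f

end SemiFredholm

/-! ### Essential spectrum of `A ⊗ 1 + 1 ⊗ B` on a Hilbert tensor product. -/

section Tensor

variable {X Y Z : Type*} [NormedAddCommGroup X] [InnerProductSpace ℂ X]
  [NormedAddCommGroup Y] [InnerProductSpace ℂ Y]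
  [NormedAddCommGroup Z] [InnerProductSpace ℂ Z]

/-- `t` exhibits `Z` as the Hilbert space tensor product of `X` and `Y`. -/
structure IsHilbertTensor (t : X →L[ℂ] Y →L[ℂ] Z) : Prop where
  inner_map : ∀ x y x' y', inner ℂ (t x y) (t x' y') = inner ℂ x x' * inner ℂ y y'
  total : ∀ z, (∀ x y, inner ℂ (t x y) z = 0) → z = 0

namespace IsHilbertTensor

variable {t : X →L[ℂ] Y →L[ℂ] Z} (ht : IsHilbertTensor t)

lemma exists_eq_sum (z : Z) (hz : z ∈ Submodule.span ℂ (Set.range fun p : X × Y => t p.1 p.2)) :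
    ∃ (s : Finset (X × Y)) (x : X × Y → X), z = ∑ p ∈ s, t (x p) p.2 := by
  obtain ⟨c, rfl⟩ := Finsupp.mem_span_range_iff_exists_finsupp.1 hz
  refine ⟨c.support, fun p => c p • p.1, Finset.sum_congr rfl fun p _ => ?_⟩
  simp

include ht

lemma flip : IsHilbertTensor t.flip where
  inner_map y x y' x' := by
    rw [ContinuousLinearMap.flip_apply, ContinuousLinearMap.flip_apply, ht.inner_map, mul_comm]
  total z h := ht.total z fun x y => h y x

lemma norm_map (x : X) (y : Y) : ‖t x y‖ = ‖x‖ * ‖y‖ := by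
  have h : ‖t x y‖ ^ 2 = (‖x‖ * ‖y‖) ^ 2 := by
    have h1 := ht.inner_map x y x y
    rw [inner_self_eq_norm_sq_to_K, inner_self_eq_norm_sq_to_K, inner_self_eq_norm_sq_to_K,
      ← mul_pow] at h1
    exact_mod_cast h1
  exact (sq_eq_sq₀ (norm_nonneg _) (by positivity)).1 h

variable [CompleteSpace Z]

lemma dense_span :
    Dense (Submodule.span ℂ (Set.range fun p : X × Y => t p.1 p.2) : Set Z) := by
  rw [Submodule.dense_iff_topologicalClosure_eq_top, Submodule.topologicalClosure_eq_top_iff,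
    Submodule.eq_bot_iff]
  exact fun z hz => ht.total z fun x y => hz _ (Submodule.subset_span ⟨(x, y), rfl⟩)

lemma ext_op {S S' : Z →L[ℂ] Z} (h : ∀ x y, S (t x y) = S' (t x y)) : S = S' := by
  refine DFunLike.coe_injective (S.continuous.ext_on ht.dense_span S'.continuous ?_)
  intro z hz
  obtain ⟨s, x, rfl⟩ := exists_eq_sum z hz
  simp [h]

lemma isSelfAdjoint [CompleteSpace X] {A : X →L[ℂ] X} (hA : IsSelfAdjoint A) {T : Z →L[ℂ] Z}
    (hT : ∀ x y, T (t x y) = t (A x) y) : IsSelfAdjoint T := by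
  rw [ContinuousLinearMap.isSelfAdjoint_iff']
  refine ht.ext_op fun x y => ?_
  rw [← sub_eq_zero]
  refine ht.total _ fun x' y' => ?_
  have := hA.isSymmetric x' x
  rw [ContinuousLinearMap.coe_coe] at this
  rw [inner_sub_right, ContinuousLinearMap.adjoint_inner_right, hT, hT, ht.inner_map,
    ht.inner_map, this, sub_self]

/-- With `B = √A`, the form at `∑ xₚ ⊗ yₚ` equals `‖∑ B xₚ ⊗ yₚ‖²`; density of such sums does the
rest. The operator `B ⊗ 1` itself is never constructed. -/
lemma re_inner_nonneg [CompleteSpace X] {A : X →L[ℂ] X} (hA : 0 ≤ A) {T : Z →L[ℂ] Z}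
    (hT : ∀ x y, T (t x y) = t (A x) y) (z : Z) : 0 ≤ (inner ℂ (T z) z).re := by
  have hcl : IsClosed {z : Z | 0 ≤ (inner ℂ (T z) z).re} :=
    isClosed_le continuous_const
      (Complex.continuous_re.comp (T.continuous.inner continuous_id))
  refine hcl.closure_subset_iff.2 ?_ (ht.dense_span z)
  intro z hz
  obtain ⟨s, x, rfl⟩ := exists_eq_sum z hz
  set B := CFC.sqrt A
  have hB : IsSelfAdjoint B := (CFC.sqrt_nonneg A).isSelfAdjoint
  have hBB : ∀ x, B (B x) = A x := fun x => DFunLike.congr_fun (CFC.sqrt_mul_sqrt_self A hA) x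
  have e : inner ℂ (T (∑ p ∈ s, t (x p) p.2)) (∑ p ∈ s, t (x p) p.2) =
      inner ℂ (∑ p ∈ s, t (B (x p)) p.2) (∑ p ∈ s, t (B (x p)) p.2) := by
    simp only [map_sum, sum_inner, inner_sum, hT, ht.inner_map]
    refine Finset.sum_congr rfl fun p _ => Finset.sum_congr rfl fun q _ => ?_
    rw [← hBB]
    congr 1
    exact hB.isSymmetric _ _
  rw [Set.mem_ofPred_eq, e]
  exact inner_self_nonneg (𝕜 := ℂ)

variable [CompleteSpace Y]

/-- Thus `(t φ).adjoint` is the partial inner product with `φ`, which extracts the component of a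
tensor along `φ`. -/
lemma adjoint_apply (φ x : X) (y : Y) : (t φ).adjoint (t x y) = inner ℂ φ x • y := by
  refine ext_inner_left ℂ fun w => ?_
  rw [ContinuousLinearMap.adjoint_inner_right, ht.inner_map, inner_smul_right]

lemma norm_adjoint_apply_le (φ : X) (z : Z) : ‖(t φ).adjoint z‖ ≤ ‖φ‖ * ‖z‖ := by
  refine ((t φ).adjoint.le_opNorm z).trans ?_
  gcongr
  rw [LinearIsometryEquiv.norm_map]
  exact (t φ).opNorm_le_bound (norm_nonneg _) fun y => (ht.norm_map φ y).le

variable {A : X →L[ℂ] X} {B : Y →L[ℂ] Y} {T : Z →L[ℂ] Z}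

/-- On `φ ⊗ Y` the operator `T - x` acts as `B - (x - a)`, and `t φ` is an isometry, so the bound
for `T` restricts. The contrapositive places `a + σ_e(B)` inside `σ_e(T)`. -/
lemma isSemiFredholmAt_right (hT : ∀ x y, T (t x y) = t (A x) y + t x (B y)) {φ : X} {a x : ℝ}
    (hφ : ‖φ‖ = 1) (hAφ : A φ = (a : ℂ) • φ) (h : IsSemiFredholmAt T x) :
    IsSemiFredholmAt B (x - a) := by
  obtain ⟨V, hV, c, hc, h⟩ := h
  refine ⟨V.map ((t φ).adjoint : Z →ₗ[ℂ] Y), inferInstance, c, hc, fun f hf => ?_⟩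
  have h1 := h (t φ f) fun v hv => by
    rw [← ContinuousLinearMap.adjoint_inner_left]
    exact hf _ (Submodule.mem_map_of_mem hv)
  have h2 : T (t φ f) - (x : ℂ) • t φ f = t φ (B f - ((x - a : ℝ) : ℂ) • f) := by
    rw [hT, hAφ]
    push_cast
    simp only [map_smul, map_sub, sub_smul, _root_.smul_apply]
    abel
  rwa [h2, ht.norm_map, ht.norm_map, hφ, one_mul, one_mul] at h1

/-- Partial inner product with the eigenvector `φ` intertwines `T - x` with `B - (x - a)`, so the
lower bound for the latter controls the component of `z` along `φ` once `z` is orthogonal to `φ ⊗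
V`. -/
lemma exists_adjoint_bound (hTs : IsSelfAdjoint T)
    (hB : IsSelfAdjoint B)
    (hT : ∀ x y, T (t x y) = t (A x) y + t x (B y)) {φ : X} {a x : ℝ}
    (hφ : ‖φ‖ = 1) (hAφ : A φ = (a : ℂ) • φ) (h : IsSemiFredholmAt B (x - a)) :
    ∃ (W : Submodule ℂ Z) (K : ℝ), FiniteDimensional ℂ W ∧ 0 ≤ K ∧
      ∀ z ∈ Wᗮ, ‖(t φ).adjoint z‖ ≤ K * ‖T z - (x : ℂ) • z‖ := by
  obtain ⟨V, hV, c, hc, h⟩ := h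
  refine ⟨V.map (t φ : Y →ₗ[ℂ] Z), c⁻¹, inferInstance, by positivity, fun z hz => ?_⟩
  have h1 := h ((t φ).adjoint z) fun v hv => by
    rw [ContinuousLinearMap.adjoint_inner_right]
    exact hz _ (Submodule.mem_map_of_mem hv)
  have h2 : B ((t φ).adjoint z) - ((x - a : ℝ) : ℂ) • (t φ).adjoint z =
      (t φ).adjoint (T z - (x : ℂ) • z) := by
    refine ext_inner_left ℂ fun w => ?_
    rw [← inner_sub_smul hB, ContinuousLinearMap.adjoint_inner_right,
      ContinuousLinearMap.adjoint_inner_right, ← inner_sub_smul hTs, hT, hAφ]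
    congr 1
    push_cast
    simp only [map_smul, map_sub, sub_smul, _root_.smul_apply]
    abel
  rw [h2] at h1
  rw [le_inv_mul_iff₀ hc]
  refine h1.trans ((ht.norm_adjoint_apply_le φ _).trans ?_)
  rw [hφ, one_mul]

/-- In each square one factor is estimated trivially by `‖z‖`, leaving a bound linear in `‖T z - x
z‖` that can be combined with Cauchy–Schwarz. -/
lemma exists_adjoint_bound_family (hTs : IsSelfAdjoint T)
    (hB : IsSelfAdjoint B)
    (hT : ∀ x y, T (t x y) = t (A x) y + t x (B y)) {ι : Type*} [Fintype ι] {φ : ι → X}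
    {a : ι → ℝ} {x : ℝ} (hφ : ∀ i, ‖φ i‖ = 1) (hAφ : ∀ i, A (φ i) = (a i : ℂ) • φ i)
    (h : ∀ i, IsSemiFredholmAt B (x - a i)) :
    ∃ (W : Submodule ℂ Z) (K : ℝ), FiniteDimensional ℂ W ∧ 0 ≤ K ∧
      ∀ z ∈ Wᗮ, ∑ i, ‖(t (φ i)).adjoint z‖ ^ 2 ≤ ‖z‖ * (K * ‖T z - (x : ℂ) • z‖) := by
  choose W K hW hK hb using fun i =>
    ht.exists_adjoint_bound hTs hB hT (hφ i) (hAφ i) (h i)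
  refine ⟨⨆ i, W i, ∑ i, K i, inferInstance, Finset.sum_nonneg fun i _ => hK i, fun z hz => ?_⟩
  rw [Finset.sum_mul, Finset.mul_sum]
  refine Finset.sum_le_sum fun i _ => ?_
  have h1 := hb i z (Submodule.orthogonal_le (le_iSup W i) hz)
  have h2 := ht.norm_adjoint_apply_le (φ i) z
  rw [hφ, one_mul] at h2
  rw [sq]
  exact mul_le_mul h2 h1 (norm_nonneg _) (norm_nonneg _)

variable [CompleteSpace X]

/-- A lower bound for the quadratic form of `A` yields one for that of `A ⊗ 1`. -/
lemma form_bound (hA : IsSelfAdjoint A)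
    (hT : ∀ x y, T (t x y) = t (A x) y) {ι : Type*} [Fintype ι] (φ : ι → X) {ε C : ℝ}
    (h : ∀ f, 0 ≤ (inner ℂ (A f) f).re + ε * ‖f‖ ^ 2 + C * ∑ i, ‖inner ℂ (φ i) f‖ ^ 2) (z : Z) :
    0 ≤ (inner ℂ (T z) z).re + ε * ‖z‖ ^ 2 + C * ∑ i, ‖(t (φ i)).adjoint z‖ ^ 2 := by
  -- The hypothesis says that `A'`, which is `A + ε` plus `C` times the rank-one operators of the `φ
  -- i`, is positive; `T'` is `A' ⊗ 1`, so positivity transfers to it.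
  let A' : X →L[ℂ] X := A + (ε : ℂ) • ContinuousLinearMap.id ℂ X +
    (C : ℂ) • ∑ i, (innerSL ℂ (φ i)).smulRight (φ i)
  let T' : Z →L[ℂ] Z := T + (ε : ℂ) • ContinuousLinearMap.id ℂ Z +
    (C : ℂ) • ∑ i, (t (φ i)) ∘L (t (φ i)).adjoint
  have hA'f : ∀ f, A' f = A f + (ε : ℂ) • f + (C : ℂ) • ∑ i, inner ℂ (φ i) f • φ i := fun f => by
    simp [A']
  have hT'f : ∀ f, T' f = T f + (ε : ℂ) • f + (C : ℂ) • ∑ i, t (φ i) ((t (φ i)).adjoint f) :=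
    fun f => by simp [T']
  have hT' : ∀ x y, T' (t x y) = t (A' x) y := fun x y => by
    rw [hT'f, hA'f]
    simp [hT, ht.adjoint_apply]
  have hA's : (A' : X →ₗ[ℂ] X).IsSymmetric := fun f g => by
    have := hA.isSymmetric f g
    simp only [ContinuousLinearMap.coe_coe] at this ⊢
    simp only [hA'f, inner_add_left, inner_add_right, inner_smul_left, inner_smul_right,
      sum_inner, inner_sum, this, Complex.conj_ofReal, inner_conj_symm]
    congr 2
    exact Finset.sum_congr rfl fun i _ => mul_comm _ _
  have hA'0 : 0 ≤ A' := by
    rw [ContinuousLinearMap.nonneg_iff_isPositive, ContinuousLinearMap.isPositive_def]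
    refine ⟨hA's, fun f => (h f).trans_eq ?_⟩
    rw [ContinuousLinearMap.reApplyInnerSelf_apply, hA'f]
    simp only [inner_add_left, inner_smul_left, sum_inner, Complex.conj_ofReal,
      inner_self_eq_norm_sq_to_K, RCLike.conj_mul]
    simp [← Complex.ofReal_pow]
  refine (ht.re_inner_nonneg hA'0 hT' z).trans_eq ?_
  rw [hT'f]
  simp only [inner_add_left, inner_smul_left, sum_inner, Complex.conj_ofReal,
    inner_self_eq_norm_sq_to_K, ← ContinuousLinearMap.adjoint_inner_right]
  simp [← Complex.ofReal_pow]

/-- The upper bound for the essential spectrum of `A ⊗ 1 + 1 ⊗ B`: if `ε` bounds the negative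
parts of `A` and `B` up to the eigenvectors `φ i` and `ψ j`, then below `-2ε` the essential
spectrum lies in the union of the sets `a i + σ_e(B)` and `b j + σ_e(A)`. -/
lemma isSemiFredholmAt_add (hA : IsSelfAdjoint A) (hB : IsSelfAdjoint B) {T₁ T₂ : Z →L[ℂ] Z}
    (hT₁ : ∀ x y, T₁ (t x y) = t (A x) y) (hT₂ : ∀ x y, T₂ (t x y) = t x (B y))
    {ι κ : Type*} [Fintype ι] [Fintype κ] {φ : ι → X} {a : ι → ℝ} {ψ : κ → Y} {b : κ → ℝ}
    {x ε C D : ℝ} (hC : 0 ≤ C) (hD : 0 ≤ D)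
    (hφ : ∀ i, ‖φ i‖ = 1) (hAφ : ∀ i, A (φ i) = (a i : ℂ) • φ i)
    (hψ : ∀ j, ‖ψ j‖ = 1) (hBψ : ∀ j, B (ψ j) = (b j : ℂ) • ψ j)
    (hAf : ∀ f, 0 ≤ (inner ℂ (A f) f).re + ε * ‖f‖ ^ 2 + C * ∑ i, ‖inner ℂ (φ i) f‖ ^ 2)
    (hBf : ∀ f, 0 ≤ (inner ℂ (B f) f).re + ε * ‖f‖ ^ 2 + D * ∑ j, ‖inner ℂ (ψ j) f‖ ^ 2)
    (hx : x < -(2 * ε)) (hxa : ∀ i, IsSemiFredholmAt B (x - a i))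
    (hxb : ∀ j, IsSemiFredholmAt A (x - b j)) : IsSemiFredholmAt (T₁ + T₂) x := by
  have hT : ∀ x y, (T₁ + T₂) (t x y) = t (A x) y + t x (B y) := fun x y => by
    rw [_root_.add_apply, hT₁, hT₂]
  have hT' : ∀ y x, (T₁ + T₂) (t.flip y x) = t.flip (B y) x + t.flip y (A x) := fun y x => by
    exact (hT x y).trans (add_comm _ _)
  have hTs : IsSelfAdjoint (T₁ + T₂) :=
    (ht.isSelfAdjoint hA hT₁).add (ht.flip.isSelfAdjoint hB fun y x => hT₂ x y)
  obtain ⟨W, K, hW, hK, hWK⟩ := ht.exists_adjoint_bound_family hTs hB hT hφ hAφ hxa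
  obtain ⟨W', K', hW', hK', hWK'⟩ :=
    ht.flip.exists_adjoint_bound_family hTs hA hT' hψ hBψ hxb
  -- Adding the two form bounds gives `(-x - 2ε)‖z‖² ≤ M ‖z‖ r`: the `1` comes from Cauchy–Schwarz
  -- for `⟨(T - x) z, z⟩`, the other terms from the components along the `φ i` and `ψ j`.
  set M := 1 + C * K + D * K'
  have hM : 0 < M := by positivity
  refine ⟨W ⊔ W', inferInstance, (-x - 2 * ε) / M, div_pos (by linarith) hM, fun z hz => ?_⟩
  have h1 := hWK z (Submodule.orthogonal_le le_sup_left hz)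
  have h2 := hWK' z (Submodule.orthogonal_le le_sup_right hz)
  have h3 := ht.form_bound hA hT₁ φ hAf z
  have h4 := ht.flip.form_bound hB (fun y x => hT₂ x y) ψ hBf z
  set r := ‖(T₁ + T₂) z - (x : ℂ) • z‖ with hr
  have h5 : (inner ℂ (T₁ z) z).re + (inner ℂ (T₂ z) z).re - x * ‖z‖ ^ 2 ≤ ‖z‖ * r := by
    have e : (inner ℂ ((T₁ + T₂) z - (x : ℂ) • z) z).re =
        (inner ℂ (T₁ z) z).re + (inner ℂ (T₂ z) z).re - x * ‖z‖ ^ 2 := by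
      rw [inner_sub_left, _root_.add_apply, inner_add_left, inner_smul_left,
        Complex.conj_ofReal, Complex.sub_re, Complex.add_re, Complex.re_ofReal_mul]
      congr 2
      exact inner_self_eq_norm_sq (𝕜 := ℂ) z
    rw [← e, mul_comm]
    exact (Complex.re_le_norm _).trans (norm_inner_le_norm _ _)
  have h6 : (-x - 2 * ε) * ‖z‖ ^ 2 ≤ ‖z‖ * (M * r) := by
    have := mul_le_mul_of_nonneg_left h1 hC
    have := mul_le_mul_of_nonneg_left h2 hD
    simp only [M]
    linarith
  rw [div_mul_eq_mul_div, div_le_iff₀ hM, mul_comm r]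
  rcases (norm_nonneg z).eq_or_lt with h0 | h0
  · rw [← h0, mul_zero]
    positivity
  · refine le_of_mul_le_mul_left ?_ h0
    linarith

end IsHilbertTensor

end Tensor

/-! ### Essential and discrete spectrum of the Friedrichs model. -/

section Friedrichs

instance isOpenPosMeasure_unitInterval : (volume : Measure I).IsOpenPosMeasure where
  open_pos := by
    rintro _ ⟨V, hV, rfl⟩ ⟨x, hx⟩ h0
    -- Moving into the open interval replaces a relatively open set, possibly at an endpoint, by an
    -- open subset of `ℝ`.
    have h1 : (V ∩ Set.Ioo 0 1).Nonempty := by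
      have hcl : (x : ℝ) ∈ closure (Set.Ioo (0 : ℝ) 1) := by
        rw [closure_Ioo zero_ne_one]
        exact x.2
      exact mem_closure_iff.1 hcl V hV hx
    have h2 : volume (Subtype.val '' ((Subtype.val : I → ℝ) ⁻¹' V)) = 0 := by
      rw [← h0, Measure.Subtype.volume_def, comap_subtype_coe_apply measurableSet_Icc]
    have h3 := measure_mono_null (t := Subtype.val '' ((Subtype.val : I → ℝ) ⁻¹' V))
      (s := V ∩ Set.Ioo 0 1) (fun y hy => ⟨⟨y, hy.2.1.le, hy.2.2.le⟩, hy.1, rfl⟩) h2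
    exact (hV.inter isOpen_Ioo).measure_ne_zero volume h1 h3

lemma infinite_of_isOpen {U : Set I} (hU : IsOpen U) (hne : U.Nonempty) : U.Infinite := by
  intro hf
  refine hU.measure_ne_zero volume hne ?_
  rw [Measure.Subtype.volume_def, comap_subtype_coe_apply measurableSet_Icc]
  exact (hf.image _).measure_zero _

lemma isSelfAdjoint_mulOp {Z : Type*} [TopologicalSpace Z] [CompactSpace Z] [MeasureSpace Z]
    [BorelSpace Z] (g : C(Z, ℂ)) (hg : ∀ z, star (g z) = g z) : IsSelfAdjoint (mulOp g) := by
  rw [ContinuousLinearMap.isSelfAdjoint_iff_isSymmetric]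
  intro f h
  rw [ContinuousLinearMap.coe_coe, L2.inner_def, L2.inner_def]
  refine integral_congr_ae ?_
  filter_upwards [mulOp_apply g f, mulOp_apply g h] with z h1 h2
  have := hg z
  rw [Complex.star_def] at this
  rw [h1, h2, RCLike.inner_apply, RCLike.inner_apply, map_mul, this]
  ring

/-- An integral operator is small on a subspace of finite codimension. -/
lemma exists_integralOp_small (k : C(I × I, ℂ)) {η : ℝ} (hη : 0 < η) :
    ∃ V : Submodule ℂ (L2 I), FiniteDimensional ℂ V ∧
      ∀ f ∈ Vᗮ, ‖integralOp k f‖ ≤ η * ‖f‖ := by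
  -- The conjugated rows `κ x` of the kernel form a compact set in `L²`. If `f` is orthogonal to a
  -- finite `η`-net of it, then `|(K f)(x)| = |⟨κ x - y, f⟩| ≤ η ‖f‖` for a net point `y` near `κ
  -- x`; as `[0,1]` has measure one, this uniform bound is also an `L²` bound.
  let κ : I → L2 I := fun x => ContinuousMap.toLp 2 volume ℂ ((star k).curry x)
  have hκ : Continuous κ :=
    (ContinuousMap.toLp 2 volume ℂ).continuous.comp (star k).curry.continuous
  obtain ⟨t, ht, hcov⟩ := Metric.totallyBounded_iff.1 (isCompact_range hκ).totallyBounded η hη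
  refine ⟨Submodule.span ℂ t, FiniteDimensional.span_of_finite ℂ ht, fun f hf => ?_⟩
  have hκf : ∀ x, ∫ s, k (x, s) * f s = inner ℂ (κ x) f := fun x => by
    rw [L2.inner_def]
    refine integral_congr_ae ?_
    filter_upwards [ContinuousMap.coeFn_toLp (p := 2) (𝕜 := ℂ) volume ((star k).curry x)]
      with s hs
    simp only [κ]
    rw [hs, RCLike.inner_apply, ContinuousMap.curry_apply, ContinuousMap.star_apply,
      Complex.star_def, Complex.conj_conj, mul_comm]
  have hb : ∀ x, ‖inner ℂ (κ x) f‖ ≤ η * ‖f‖ := fun x => by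
    obtain ⟨y, hy, hxy⟩ := Set.mem_iUnion₂.1 (hcov (Set.mem_range_self x))
    have h0 : inner ℂ y f = 0 := hf y (Submodule.subset_span hy)
    have h1 : inner ℂ (κ x) f = inner ℂ (κ x - y) f := by rw [inner_sub_left, h0, sub_zero]
    rw [h1]
    refine (norm_inner_le_norm _ _).trans ?_
    gcongr
    rw [← dist_eq_norm]
    exact (Metric.mem_ball.1 hxy).le
  have h := Lp.norm_le_of_ae_bound (f := integralOp k f) (C := η * ‖f‖) (by positivity) (by
    filter_upwards [partialIntegralOp_apply (fun p : I × I => p.2) measurePreserving_snd k f]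
      with x hx
    change ‖(partialIntegralOp _ _ k f) x‖ ≤ _
    rw [hx, hκf]
    exact hb x)
  simpa [measureUnivNNReal] using h

variable (w : C(I, ℝ)) (k : C(I × I, ℂ))

/-- The multiplication part of the Friedrichs model. -/
noncomputable def potentialOp : L2 I →L[ℂ] L2 I :=
  mulOp ⟨fun x => (w x : ℂ), by fun_prop⟩

lemma friedrichsOp_eq (f : L2 I) : friedrichsOp w k f = potentialOp w f - integralOp k f := rfl

lemma potentialOp_sub_apply (z : ℝ) (f : L2 I) :
    (potentialOp w f - (z : ℂ) • f : L2 I) =ᵐ[volume] fun x => ((w x - z : ℝ) : ℂ) * f x := by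
  filter_upwards [Lp.coeFn_sub (potentialOp w f) ((z : ℂ) • f), Lp.coeFn_smul (z : ℂ) f,
    mulOp_apply ⟨fun x => (w x : ℂ), by fun_prop⟩ f] with x h1 h2 h3
  rw [h1, Pi.sub_apply, h2]
  change potentialOp w f x = _ at h3
  rw [h3]
  simp only [ContinuousMap.coe_mk, Pi.smul_apply, smul_eq_mul, Complex.ofReal_sub]
  ring

lemma isSelfAdjoint_friedrichsOp (hK : (integralOp k).IsPositive) :
    IsSelfAdjoint (friedrichsOp w k) :=
  (isSelfAdjoint_mulOp _ fun x => by simp).sub hK.isSelfAdjoint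

/-- Multiplication by `w - z` is bounded below by the distance `d > 0` from `z` to the compact range
of `w`, and the integral operator costs at most `d / 2` on a subspace of finite codimension. -/
lemma isSemiFredholmAt_friedrichsOp {z : ℝ} (hz : z ∉ Set.range w) :
    IsSemiFredholmAt (friedrichsOp w k) z := by
  have hcl : IsClosed (Set.range w) := (isCompact_range w.continuous).isClosed
  have hne : (Set.range w).Nonempty := Set.range_nonempty w
  set d := Metric.infDist z (Set.range w)
  have hd : 0 < d := (hcl.notMem_iff_infDist_pos hne).1 hz
  obtain ⟨V, hV, hs⟩ := exists_integralOp_small k (half_pos hd)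
  refine ⟨V, hV, d / 2, half_pos hd, fun f hf => ?_⟩
  have h1 : ‖f‖ ≤ d⁻¹ * ‖potentialOp w f - (z : ℂ) • f‖ := by
    refine Lp.norm_le_mul_norm_of_ae_le_mul ?_
    filter_upwards [potentialOp_sub_apply w z f] with x hx
    rw [hx, norm_mul, Complex.norm_real, le_inv_mul_iff₀ hd]
    gcongr
    rw [← dist_eq_norm, dist_comm]
    exact Metric.infDist_le_dist_of_mem (Set.mem_range_self x)
  rw [le_inv_mul_iff₀ hd] at h1
  have h2 : potentialOp w f - (z : ℂ) • f =
      (friedrichsOp w k f - (z : ℂ) • f) + integralOp k f := by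
    rw [friedrichsOp_eq]
    abel
  have h3 := norm_add_le (friedrichsOp w k f - (z : ℂ) • f) (integralOp k f)
  rw [← h2] at h3
  have h4 := hs f hf
  linarith

/-- On every nonempty open set there lives a nonzero function orthogonal to a given
finite-dimensional space. -/
lemma exists_mem_orthogonal_of_isOpen {U : Set I} (hU : IsOpen U) (hne : U.Nonempty)
    (V : Submodule ℂ (L2 I)) [FiniteDimensional ℂ V] :
    ∃ f ∈ Vᗮ, f ≠ 0 ∧ ∀ᵐ x, x ∉ U → f x = 0 := by
  have : Infinite U := (infinite_of_isOpen hU hne).to_subtype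
  -- Take `dim V + 1` disjoint nonempty open subsets of `U`. Some nontrivial combination of their
  -- indicators projects to zero in `V`; it is nonzero because each of these sets has positive
  -- measure.
  obtain ⟨O, hOinf, hOopen, hOdisj⟩ := exists_seq_infinite_isOpen_pairwise_disjoint U
  let S : ℕ → Set I := fun n => Subtype.val '' O n
  have hSopen : ∀ n, IsOpen (S n) := fun n => hU.isOpenMap_subtype_val _ (hOopen n)
  have hSdisj : ∀ {m n x}, x ∈ S m → x ∈ S n → m = n := by
    rintro m n _ ⟨y, hy, rfl⟩ ⟨y', hy', h⟩
    by_contra hmn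
    rw [Subtype.ext h] at hy'
    exact Set.disjoint_left.1 (hOdisj hmn) hy hy'
  let e : ℕ → L2 I := fun n =>
    indicatorConstLp 2 (hSopen n).measurableSet (measure_ne_top volume _) (1 : ℂ)
  let L₀ : (Fin (Module.finrank ℂ V + 1) → ℂ) →ₗ[ℂ] L2 I :=
    Fintype.linearCombination ℂ (fun i => e i)
  have hL₀ : ∀ a, ∀ᵐ x, L₀ a x = ∑ i, a i * (S i).indicator (fun _ => 1) x := fun a => by
    have h1 : ∀ᵐ x, ∀ n, e n x = (S n).indicator (fun _ => 1) x :=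
      ae_all_iff.2 fun n => indicatorConstLp_coeFn
    have h2 : ∀ s : Finset (Fin (Module.finrank ℂ V + 1)),
        ∀ᵐ x, (∑ i ∈ s, a i • e i : L2 I) x = ∑ i ∈ s, a i * e i x := fun s => by
      induction s using Finset.cons_induction with
      | empty =>
        simp
      | cons j s hj ih =>
        rw [Finset.sum_cons]
        filter_upwards [ih, Lp.coeFn_add (a j • e j) (∑ i ∈ s, a i • e i),
          Lp.coeFn_smul (a j) (e j)] with x h1 h2 h3
        rw [h2, Pi.add_apply, h1, h3, Finset.sum_cons]
        rfl
    filter_upwards [h1, h2 Finset.univ] with x h1 h2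
    change (∑ i, a i • e i : L2 I) x = _
    rw [h2]
    simp only [h1]
  let L := (V.orthogonalProjectionOnto : L2 I →ₗ[ℂ] V) ∘ₗ L₀
  obtain ⟨a, ha, ha0⟩ := (Submodule.ne_bot_iff _).1
    (LinearMap.ker_ne_bot_of_finrank_lt (f := L) (by simp))
  obtain ⟨j, hj⟩ := Function.ne_iff.1 ha0
  refine ⟨L₀ a, Submodule.orthogonalProjectionOnto_eq_zero_iff.1 ha, fun h0 => ?_, ?_⟩
  · refine (hSopen j).measure_ne_zero volume ?_ ?_
    · exact (hOinf j).nonempty.image _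
    · rw [measure_eq_zero_iff_ae_notMem]
      filter_upwards [hL₀ a, Lp.coeFn_zero ℂ 2 (volume : Measure I)] with x hx hx0 hxS
      apply hj
      rw [h0, hx0, Finset.sum_eq_single j, Set.indicator_of_mem hxS, mul_one] at hx
      · exact hx.symm
      · intro i _ hij
        rw [Set.indicator_of_notMem, mul_zero]
        exact fun hi => hij (Fin.ext (hSdisj hi hxS))
      · simp
  · filter_upwards [hL₀ a] with x hx hxU
    rw [hx]
    refine Finset.sum_eq_zero fun i _ => ?_
    rw [Set.indicator_of_notMem, mul_zero]
    rintro ⟨y, -, rfl⟩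
    exact hxU y.2

/-- A nonzero `f` living where `|w - w x₀| < c / 4` and orthogonal to both exceptional spaces
satisfies `‖(H - w x₀) f‖ ≤ (c / 2) ‖f‖`, against the lower bound `c`. -/
lemma not_isSemiFredholmAt_friedrichsOp (x₀ : I) :
    ¬ IsSemiFredholmAt (friedrichsOp w k) (w x₀) := by
  rintro ⟨V, hV, c, hc, h⟩
  obtain ⟨V', hV', hs⟩ := exists_integralOp_small k (η := c / 4) (by positivity)
  have hU : IsOpen {x | dist (w x) (w x₀) < c / 4} :=
    isOpen_lt (by fun_prop) continuous_const
  obtain ⟨f, hf, hf0, hfU⟩ := exists_mem_orthogonal_of_isOpen hU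
    ⟨x₀, by rw [Set.mem_ofPred_eq, dist_self]; positivity⟩ (V ⊔ V')
  have h1 := h f (Submodule.orthogonal_le le_sup_left hf)
  have h2 := hs f (Submodule.orthogonal_le le_sup_right hf)
  have h3 : ‖potentialOp w f - (w x₀ : ℂ) • f‖ ≤ c / 4 * ‖f‖ := by
    refine Lp.norm_le_mul_norm_of_ae_le_mul ?_
    filter_upwards [potentialOp_sub_apply w (w x₀) f, hfU] with x hx hxU
    rw [hx, norm_mul, Complex.norm_real, ← dist_eq_norm]
    by_cases hx' : dist (w x) (w x₀) < c / 4
    · gcongr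
    · rw [hxU hx', norm_zero, mul_zero, mul_zero]
  have h4 : friedrichsOp w k f - (w x₀ : ℂ) • f =
      (potentialOp w f - (w x₀ : ℂ) • f) - integralOp k f := by
    rw [friedrichsOp_eq]
    abel
  have h5 := norm_sub_le (potentialOp w f - (w x₀ : ℂ) • f) (integralOp k f)
  rw [← h4] at h5
  have : 0 < c * ‖f‖ := mul_pos hc (norm_pos_iff.2 hf0)
  linarith

lemma isSemiFredholmAt_friedrichsOp_iff {z : ℝ} :
    IsSemiFredholmAt (friedrichsOp w k) z ↔ z ∉ Set.range w := by
  refine ⟨?_, isSemiFredholmAt_friedrichsOp w k⟩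
  rintro h ⟨x, rfl⟩
  exact not_isSemiFredholmAt_friedrichsOp w k x h

variable {w k}

/-- A discrete point lies off the range of `w`, which is `[0, max w]` by the intermediate value
theorem. It cannot exceed `max w`, since `K ≥ 0` makes the form of `H` at most `max w`. -/
lemma neg_of_mem_discreteSpectrum (hw : ∀ x, 0 ≤ w x) (hw₀ : ∃ x, w x = 0)
    (hK : (integralOp k).IsPositive) {z : ℝ} (hz : z ∈ discreteSpectrum (friedrichsOp w k)) :
    z < 0 := by
  have h1 := (isSemiFredholmAt_friedrichsOp_iff w k).1
    (isSemiFredholmAt_of_mem_discreteSpectrum (isSelfAdjoint_friedrichsOp w k hK) hz)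
  by_contra! hz0
  apply h1
  obtain ⟨x₀, hx₀⟩ := hw₀
  obtain ⟨x₁, -, hx₁⟩ := isCompact_univ.exists_isMaxOn Set.univ_nonempty w.continuous.continuousOn
  refine intermediate_value_univ x₀ x₁ w.continuous ⟨hx₀.trans_le hz0, ?_⟩
  obtain ⟨f, hf0, hf⟩ := isEigenvalue_iff.1 hz.2.2.1
  have h2 : ‖potentialOp w f‖ ≤ w x₁ * ‖f‖ := by
    refine Lp.norm_le_mul_norm_of_ae_le_mul ?_
    filter_upwards [mulOp_apply ⟨fun x => (w x : ℂ), by fun_prop⟩ f] with x hx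
    change potentialOp w f x = _ at hx
    rw [hx, norm_mul]
    simp only [ContinuousMap.coe_mk, Complex.norm_real, Real.norm_of_nonneg (hw x)]
    gcongr
    exact hx₁ (Set.mem_univ x)
  have h3 : z * ‖f‖ ^ 2 ≤ w x₁ * ‖f‖ ^ 2 := by
    have e : potentialOp w f = (z : ℂ) • f + integralOp k f := by
      rw [← hf, friedrichsOp_eq]
      abel
    have e1 : (inner ℂ (potentialOp w f) f).re = z * ‖f‖ ^ 2 + (inner ℂ (integralOp k f) f).re := by
      rw [e, inner_add_left, inner_smul_left, Complex.conj_ofReal, Complex.add_re,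
        Complex.re_ofReal_mul]
      congr 2
      exact inner_self_eq_norm_sq (𝕜 := ℂ) f
    have e2 : 0 ≤ (inner ℂ (integralOp k f) f).re := hK.re_inner_nonneg_left f
    have e3 : (inner ℂ (potentialOp w f) f).re ≤ w x₁ * ‖f‖ ^ 2 :=
      calc _ ≤ ‖potentialOp w f‖ * ‖f‖ :=
            (Complex.re_le_norm _).trans (norm_inner_le_norm _ _)
        _ ≤ w x₁ * ‖f‖ * ‖f‖ := by gcongr
        _ = _ := by ring
    linarith
  exact le_of_mul_le_mul_right h3 (by positivity)

end Friedrichs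

/-! ### `L²([0,1]²)` as the Hilbert tensor product of `L²[0,1]` with itself. -/

section TensorL2

lemma memLp_tensor (f g : L2 I) :
    MemLp (fun p : I × I => f p.1 * g p.2) 2 (volume : Measure (I × I)) := by
  have hm : AEStronglyMeasurable (fun p : I × I => f p.1 * g p.2) (volume : Measure (I × I)) :=
    (Lp.aestronglyMeasurable f).comp_fst.mul (Lp.aestronglyMeasurable g).comp_snd
  rw [memLp_two_iff_integrable_sq_norm hm]
  have hf := (memLp_two_iff_integrable_sq_norm (Lp.aestronglyMeasurable f)).1 (Lp.memLp f)
  have hg := (memLp_two_iff_integrable_sq_norm (Lp.aestronglyMeasurable g)).1 (Lp.memLp g)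
  refine (hf.mul_prod hg).congr (Eventually.of_forall fun p => ?_)
  simp only [norm_mul, mul_pow]

lemma ae_fst {P : I → Prop} (h : ∀ᵐ x, P x) : ∀ᵐ p : I × I, P p.1 :=
  (measurePreserving_fst (μ := (volume : Measure I))
    (ν := (volume : Measure I))).quasiMeasurePreserving.ae h

lemma ae_snd {P : I → Prop} (h : ∀ᵐ x, P x) : ∀ᵐ p : I × I, P p.2 :=
  (measurePreserving_snd (μ := (volume : Measure I))
    (ν := (volume : Measure I))).quasiMeasurePreserving.ae h

lemma inner_toLp_tensor (f g f' g' : L2 I) :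
    inner ℂ ((memLp_tensor f g).toLp _) ((memLp_tensor f' g').toLp _) =
      inner ℂ f f' * inner ℂ g g' := by
  rw [L2.inner_def, L2.inner_def, L2.inner_def]
  have := integral_prod_mul (μ := (volume : Measure I)) (ν := (volume : Measure I))
    (fun x => inner ℂ (f x) (f' x)) (fun y => inner ℂ (g y) (g' y))
  rw [← this]
  refine integral_congr_ae ?_
  filter_upwards [(memLp_tensor f g).coeFn_toLp, (memLp_tensor f' g').coeFn_toLp] with p h1 h2
  rw [h1, h2]
  simp only [RCLike.inner_apply, map_mul]
  ring

/-- The tensor product of functions, `(f ⊗ g)(x, y) = f(x) g(y)`. -/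
noncomputable def tensorL2 : L2 I →L[ℂ] L2 I →L[ℂ] L2 (I × I) :=
  LinearMap.mkContinuous₂
    (LinearMap.mk₂ ℂ (fun f g => (memLp_tensor f g).toLp _)
      (fun f f' g => by
        rw [← MemLp.toLp_add, MemLp.toLp_eq_toLp_iff]
        filter_upwards [ae_fst (Lp.coeFn_add f f')] with p h
        simp only [h, Pi.add_apply, add_mul])
      (fun c f g => by
        rw [← MemLp.toLp_const_smul, MemLp.toLp_eq_toLp_iff]
        filter_upwards [ae_fst (Lp.coeFn_smul c f)] with p h
        simp only [h, Pi.smul_apply, smul_eq_mul, mul_assoc])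
      (fun f g g' => by
        rw [← MemLp.toLp_add, MemLp.toLp_eq_toLp_iff]
        filter_upwards [ae_snd (Lp.coeFn_add g g')] with p h
        simp only [h, Pi.add_apply, mul_add])
      (fun c f g => by
        rw [← MemLp.toLp_const_smul, MemLp.toLp_eq_toLp_iff]
        filter_upwards [ae_snd (Lp.coeFn_smul c g)] with p h
        simp only [h, Pi.smul_apply, smul_eq_mul]
        ring)) 1 (fun f g => by
      rw [one_mul, LinearMap.mk₂_apply]
      have h := inner_toLp_tensor f g f g
      rw [inner_self_eq_norm_sq_to_K, inner_self_eq_norm_sq_to_K, inner_self_eq_norm_sq_to_K,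
        ← mul_pow] at h
      refine ((sq_eq_sq₀ (norm_nonneg _) (by positivity)).1 ?_).le
      exact_mod_cast h)

lemma tensorL2_apply (f g : L2 I) :
    tensorL2 f g =ᵐ[volume] fun p => f p.1 * g p.2 :=
  (memLp_tensor f g).coeFn_toLp

/-- Totality: testing against products of indicators shows that `h` integrates to zero over
measurable rectangles, hence by the π-λ theorem over all measurable sets. -/
lemma isHilbertTensor_tensorL2 : IsHilbertTensor tensorL2 where
  inner_map := inner_toLp_tensor
  total h hh := by
    have hint : Integrable h := (Lp.memLp h).integrable (by norm_num)
    have hrect : ∀ s t : Set I, MeasurableSet s → MeasurableSet t → ∫ p in s ×ˢ t, h p = 0 := by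
      intro s t hs ht
      rw [← hh (indicatorConstLp 2 hs (measure_ne_top volume _) 1)
        (indicatorConstLp 2 ht (measure_ne_top volume _) 1), L2.inner_def,
        ← integral_indicator (hs.prod ht)]
      refine integral_congr_ae ?_
      filter_upwards [tensorL2_apply (indicatorConstLp 2 hs (measure_ne_top volume _) 1)
        (indicatorConstLp 2 ht (measure_ne_top volume _) 1),
        ae_fst (indicatorConstLp_coeFn (p := 2) (hs := hs)
          (hμs := measure_ne_top volume _) (c := (1 : ℂ))),
        ae_snd (indicatorConstLp_coeFn (p := 2) (hs := ht)
          (hμs := measure_ne_top volume _) (c := (1 : ℂ)))] with p h1 h2 h3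
      rw [h1, h2, h3]
      by_cases hp1 : p.1 ∈ s <;> by_cases hp2 : p.2 ∈ t <;>
        simp [Set.indicator, hp1, hp2]
    have hall : ∀ s, MeasurableSet s → ∫ p in s, h p = 0 := by
      intro s hs
      induction s, hs using MeasurableSpace.induction_on_inter generateFrom_prod.symm
        isPiSystem_prod with
      | empty => simp
      | basic s hs =>
        obtain ⟨a, ha, b, hb, rfl⟩ := hs
        exact hrect a b ha hb
      | compl s hs ih =>
        have h1 := integral_add_compl hs hint
        have h2 := hrect Set.univ Set.univ .univ .univ
        rw [Set.univ_prod_univ, setIntegral_univ] at h2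
        rw [ih, zero_add] at h1
        rw [h1, h2]
      | iUnion f hd hf ih =>
        rw [integral_iUnion hf hd hint.integrableOn]
        simp [ih]
    refine Lp.ext ?_
    filter_upwards [hint.ae_eq_zero_of_forall_setIntegral_eq_zero fun s hs _ => hall s hs,
      Lp.coeFn_zero ℂ 2 (volume : Measure (I × I))] with p h1 h2
    rw [h1, h2]

end TensorL2

/-! ### Splitting `T` into operators acting in one variable each. -/

section ThreeParticle

variable (u v : C(I, ℝ)) (k₁ k₂ : C(I × I, ℂ))

/-- The Friedrichs model acting in the first variable. -/
noncomputable def friedrichsOp₁ : L2 (I × I) →L[ℂ] L2 (I × I) :=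
  mulOp ⟨fun p => (u p.1 : ℂ), by fun_prop⟩ - interactionOp₁ k₁

/-- The Friedrichs model acting in the second variable. -/
noncomputable def friedrichsOp₂ : L2 (I × I) →L[ℂ] L2 (I × I) :=
  mulOp ⟨fun p => (v p.2 : ℂ), by fun_prop⟩ - interactionOp₂ k₂

lemma threeParticleOp_eq :
    threeParticleOp u v k₁ k₂ = friedrichsOp₁ u k₁ + friedrichsOp₂ v k₂ := by
  have h : freeOp u v = mulOp ⟨fun p => (u p.1 : ℂ), by fun_prop⟩ +
      mulOp ⟨fun p => (v p.2 : ℂ), by fun_prop⟩ := by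
    ext1 f
    refine Lp.ext ?_
    rw [_root_.add_apply]
    filter_upwards [mulOp_apply ⟨fun p : I × I => ((u p.1 + v p.2 : ℝ) : ℂ), by fun_prop⟩ f,
      mulOp_apply ⟨fun p : I × I => (u p.1 : ℂ), by fun_prop⟩ f,
      mulOp_apply ⟨fun p : I × I => (v p.2 : ℂ), by fun_prop⟩ f,
      Lp.coeFn_add (mulOp ⟨fun p : I × I => (u p.1 : ℂ), by fun_prop⟩ f)
        (mulOp ⟨fun p : I × I => (v p.2 : ℂ), by fun_prop⟩ f)] with p h1 h2 h3 h4
    rw [h4, Pi.add_apply, h2, h3]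
    refine h1.trans ?_
    simp only [ContinuousMap.coe_mk, Complex.ofReal_add]
    ring
  rw [threeParticleOp, h, friedrichsOp₁, friedrichsOp₂]
  abel

lemma friedrichsOp₁_tensor (f g : L2 I) :
    friedrichsOp₁ u k₁ (tensorL2 f g) = tensorL2 (friedrichsOp u k₁ f) g := by
  refine Lp.ext ?_
  -- Slices with the second variable fixed are needed, so the almost-everywhere identity is swapped
  -- before Fubini.
  have hslice : ∀ᵐ p : I × I, ∀ᵐ s : I, tensorL2 f g (s, p.2) = f s * g p.2 := by
    have h := Measure.measurePreserving_swap (μ := (volume : Measure I))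
      (ν := (volume : Measure I)) |>.quasiMeasurePreserving.ae (tensorL2_apply f g)
    exact ae_snd (Measure.ae_ae_of_ae_prod h)
  filter_upwards [Lp.coeFn_sub (mulOp ⟨fun p : I × I => (u p.1 : ℂ), by fun_prop⟩ (tensorL2 f g))
      (interactionOp₁ k₁ (tensorL2 f g)),
    mulOp_apply ⟨fun p : I × I => (u p.1 : ℂ), by fun_prop⟩ (tensorL2 f g),
    interactionOp₁_apply k₁ (tensorL2 f g), tensorL2_apply f g,
    tensorL2_apply (friedrichsOp u k₁ f) g, ae_fst (friedrichsOp_apply u k₁ f), hslice]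
    with p h1 h2 h3 h4 h5 h6 h7
  rw [h5, h6]
  refine h1.trans ?_
  rw [Pi.sub_apply, h2, h3, h4, integral_congr_ae (g := fun s => k₁ (p.1, s) * f s * g p.2)
    (by filter_upwards [h7] with s hs; rw [hs]; ring), integral_mul_const]
  simp only [ContinuousMap.coe_mk]
  ring

lemma friedrichsOp₂_tensor (f g : L2 I) :
    friedrichsOp₂ v k₂ (tensorL2 f g) = tensorL2 f (friedrichsOp v k₂ g) := by
  refine Lp.ext ?_
  have hslice : ∀ᵐ p : I × I, ∀ᵐ s : I, tensorL2 f g (p.1, s) = f p.1 * g s :=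
    ae_fst (Measure.ae_ae_of_ae_prod (tensorL2_apply f g))
  filter_upwards [Lp.coeFn_sub (mulOp ⟨fun p : I × I => (v p.2 : ℂ), by fun_prop⟩ (tensorL2 f g))
      (interactionOp₂ k₂ (tensorL2 f g)),
    mulOp_apply ⟨fun p : I × I => (v p.2 : ℂ), by fun_prop⟩ (tensorL2 f g),
    interactionOp₂_apply k₂ (tensorL2 f g), tensorL2_apply f g,
    tensorL2_apply f (friedrichsOp v k₂ g), ae_snd (friedrichsOp_apply v k₂ g), hslice]
    with p h1 h2 h3 h4 h5 h6 h7
  rw [h5, h6]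
  refine h1.trans ?_
  rw [Pi.sub_apply, h2, h3, h4, integral_congr_ae (g := fun s => f p.1 * (k₂ (p.2, s) * g s))
    (by filter_upwards [h7] with s hs; rw [hs]; ring), integral_const_mul]
  simp only [ContinuousMap.coe_mk]
  ring

end ThreeParticle

/-! ### Listing points with multiplicity in increasing order. -/

section Enumeration

/-- Finite initial segments make the order locally finite with a least element, and infinitude then
rules out a greatest one. -/
lemma nonempty_orderIso_nat {G : Type*} [LinearOrder G] [Infinite G]
    (h : ∀ g : G, (Set.Iic g).Finite) : Nonempty (G ≃o ℕ) := by
  classical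
  let _ : LocallyFiniteOrder G := LocallyFiniteOrder.ofFiniteIcc fun a b =>
    (h b).subset fun x hx => hx.2
  obtain ⟨g₀⟩ : Nonempty G := inferInstance
  obtain ⟨m, hm⟩ := (h g₀).exists_minimal ⟨g₀, le_rfl⟩
  let _ : OrderBot G :=
    { bot := m
      bot_le := fun a => by
        rcases le_total a m with ha | ha
        · exact hm.2 (ha.trans hm.1) ha
        · exact ha }
  let _ : SuccOrder G := LinearLocallyFiniteOrder.succOrder G
  let _ : PredOrder G := LinearLocallyFiniteOrder.predOrder G
  have : NoMaxOrder G := ⟨fun a => by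
    by_contra! hmax
    exact Set.infinite_univ ((h a).subset fun x _ => hmax x)⟩
  exact ⟨orderIsoNatOfLinearSuccPredArch⟩

/-- A sequence running through the support of `m` in increasing order, each point `x` being
repeated `m x` times. -/
lemma exists_monotone_enumeration {m : ℝ → ℕ∞} (hm : ∀ x < 0, m x < ⊤)
    (hfin : ∀ r < 0, {x | x ≤ r ∧ m x ≠ 0}.Finite) (hinf : {x | x < 0 ∧ m x ≠ 0}.Infinite) :
    ∃ β : ℕ → ℝ, Monotone β ∧ (∀ n, β n < 0) ∧ ∀ x < 0, {n | β n = x}.encard = m x := by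
  -- One pair `(x, i)` for each copy `i < m x` of a point `x < 0`. Initial segments of the
  -- lexicographic order are finite, so `G` is order isomorphic to `ℕ`, and `β` is the first
  -- coordinate.
  let G := {g : ℝ ×ₗ ℕ // (ofLex g).1 < 0 ∧ ((ofLex g).2 : ℕ∞) < m (ofLex g).1}
  have hG : ∀ g : G, (Set.Iic g).Finite := by
    rintro ⟨g, hg0, hg⟩
    have hF : (⋃ x ∈ {x | x ≤ (ofLex g).1 ∧ m x ≠ 0},
        Prod.mk x '' {i : ℕ | (i : ℕ∞) < m x}).Finite := by
      refine (hfin _ hg0).biUnion fun x hx => Set.Finite.image _ ?_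
      obtain ⟨k, hk⟩ := ENat.ne_top_iff_exists.1 (hm x (hx.1.trans_lt hg0)).ne
      rw [← hk]
      simp only [Nat.cast_lt]
      exact Set.finite_lt_nat k
    refine Set.Finite.of_finite_image (f := fun y : G => ofLex y.1) (hF.subset ?_) ?_
    · rintro _ ⟨⟨y, hy0, hy⟩, hle, rfl⟩
      have hle' : y ≤ g := hle
      have h1 : (ofLex y).1 ≤ (ofLex g).1 := by
        rcases (Prod.Lex.le_iff (x := y) (y := g)).1 hle' with h | h
        · exact h.le
        · exact h.1.le
      exact Set.mem_biUnion (x := (ofLex y).1) ⟨h1, (pos_of_gt hy).ne'⟩ ⟨(ofLex y).2, hy, rfl⟩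
    · exact fun a _ b _ hab => Subtype.ext (ofLex.injective hab)
  have : Infinite G := by
    have := hinf.to_subtype
    exact Infinite.of_injective (β := {x | x < 0 ∧ m x ≠ 0})
      (fun x => ⟨toLex (x.1, 0), x.2.1, by simpa [pos_iff_ne_zero] using x.2.2⟩)
      fun x y hxy => Subtype.ext (congrArg (fun g : G => (ofLex g.1).1) hxy)
  obtain ⟨e⟩ := nonempty_orderIso_nat hG
  refine ⟨fun n => (ofLex (e.symm n).1).1, fun a b hab => ?_, fun n => (e.symm n).2.1,
    fun x hx => ?_⟩
  · have h1 : (e.symm a).1 ≤ (e.symm b).1 := e.symm.monotone hab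
    rcases (Prod.Lex.le_iff).1 h1 with h | h
    · exact h.le
    · exact h.1.le
  · obtain ⟨k, hk⟩ := ENat.ne_top_iff_exists.1 (hm x hx).ne
    have himg : (fun n => (ofLex (e.symm n).1).2) '' {n | (ofLex (e.symm n).1).1 = x} =
        Set.Iio k := by
      ext i
      constructor
      · rintro ⟨n, hn, rfl⟩
        have := (e.symm n).2.2
        rw [Set.mem_ofPred_eq] at hn
        rw [hn, ← hk, Nat.cast_lt] at this
        exact this
      · intro hi
        refine ⟨e ⟨toLex (x, i), hx, ?_⟩, ?_, ?_⟩
        · change (i : ℕ∞) < m x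
          rw [← hk, Nat.cast_lt]
          exact hi
        · simp
        · simp
    have hinj : Set.InjOn (fun n => (ofLex (e.symm n).1).2)
        {n | (ofLex (e.symm n).1).1 = x} := by
      intro a ha b hb hab
      rw [Set.mem_ofPred_eq] at ha hb
      exact e.symm.injective (Subtype.ext (ofLex.injective (Prod.ext (ha.trans hb.symm) hab)))
    rw [← hinj.encard_image, himg, ← hk, Set.encard_eq_coe_toFinset_card]
    simp

end Enumeration

/-! ### Accumulation of the eigenvalues and isolation of `α` from the left. -/

section Main

lemma IsHilbertTensor.isEigenvalue_add {X Y Z : Type*} [NormedAddCommGroup X]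
    [InnerProductSpace ℂ X] [NormedAddCommGroup Y] [InnerProductSpace ℂ Y]
    [NormedAddCommGroup Z] [InnerProductSpace ℂ Z] {t : X →L[ℂ] Y →L[ℂ] Z}
    (ht : IsHilbertTensor t) {A : X →L[ℂ] X} {B : Y →L[ℂ] Y} {T : Z →L[ℂ] Z}
    (hT : ∀ x y, T (t x y) = t (A x) y + t x (B y)) {a b : ℝ} (ha : IsEigenvalue A a)
    (hb : IsEigenvalue B b) : IsEigenvalue T (a + b) := by
  obtain ⟨φ, hφ0, hφ⟩ := isEigenvalue_iff.1 ha
  obtain ⟨ψ, hψ0, hψ⟩ := isEigenvalue_iff.1 hb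
  refine isEigenvalue_iff.2 ⟨t φ ψ, ?_, ?_⟩
  · rw [← norm_ne_zero_iff, ht.norm_map]
    exact mul_ne_zero (norm_ne_zero_iff.2 hφ0) (norm_ne_zero_iff.2 hψ0)
  · rw [hT, hφ, hψ]
    simp [add_smul]

/-- If the discrete spectrum of `A` is infinite and negative, and `A` has no negative essential
spectrum, then its negative eigenvalues form a sequence that tends to `0`. -/
lemma exists_isNegativeEigenvalueList {E : Type*} [NormedAddCommGroup E] [InnerProductSpace ℂ E]
    [CompleteSpace E] {A : E →L[ℂ] E} (hA : IsSelfAdjoint A)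
    (h : ∀ x < 0, IsSemiFredholmAt A x) (hneg : ∀ x ∈ discreteSpectrum A, x < 0)
    (hinf : (discreteSpectrum A).Infinite) :
    ∃ β : ℕ → ℝ, IsNegativeEigenvalueList A β ∧ (∀ n, IsEigenvalue A (β n)) ∧
      Tendsto β atTop (𝓝 0) := by
  have hfin : ∀ r < 0, {x | x ≤ r ∧ multiplicity A x ≠ 0}.Finite := fun r hr =>
    (finite_spectrum_inter_Iic hA fun x hx => h x (hx.trans_lt hr)).subset fun x hx =>
      ⟨(not_not.1 (multiplicity_eq_zero_iff.not.1 hx.2)).mem_spectrum, hx.1⟩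
  have hinf' : {x | x < 0 ∧ multiplicity A x ≠ 0}.Infinite := hinf.mono fun x hx =>
    ⟨hneg x hx, multiplicity_eq_zero_iff.not.2 (not_not.2 hx.2.2.1)⟩
  obtain ⟨β, hβm, hβ0, hβ⟩ := exists_monotone_enumeration
    (fun x hx => multiplicity_lt_top_iff.2 (h x hx).finiteDimensional_eigenspace) hfin hinf'
  refine ⟨β, ⟨hβm, hβ0, hβ⟩, fun n => ?_, tendsto_order.2 ⟨fun r hr => ?_, fun r hr =>
    Eventually.of_forall fun n => (hβ0 n).trans hr⟩⟩
  · by_contra hn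
    rw [← multiplicity_eq_zero_iff, ← hβ _ (hβ0 n), Set.encard_eq_zero] at hn
    exact Set.notMem_empty n (hn ▸ (rfl : β n = β n))
  -- By monotonicity, if `β` is not eventually above `r` then it never is; all negative eigenvalues
  -- would be at most `r`, hence finite in number.
  · by_contra hcon
    apply hinf'
    refine (hfin r hr).subset fun x hx => ⟨?_, hx.2⟩
    have h1 : {n | β n = x}.Nonempty := by
      rw [← Set.encard_ne_zero, hβ x hx.1]
      exact hx.2
    obtain ⟨n, rfl⟩ := h1
    by_contra! hlt
    exact hcon (eventually_atTop.2 ⟨n, fun k hk => hlt.trans_le (hβm hk)⟩)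

/-- If `a + range w` is contained in `S`, then points to the left of a left endpoint of a
component of `S` and close to it do not belong to `a + range w`. -/
lemma eventually_sub_notMem_range {S : Set ℝ} {α a : ℝ} (hα : α ∈ componentLeftEndpoints S)
    {w : C(I, ℝ)} (hw : ∀ x, 0 ≤ w x) (hw₀ : ∃ x, w x = 0)
    (hS : ∀ y, y - a ∈ Set.range w → y ∈ S) :
    ∀ᶠ x in 𝓝[<] α, x - a ∉ Set.range w := by
  rcases le_or_gt α a with h | h
  · filter_upwards [self_mem_nhdsWithin] with x hx
    rintro ⟨y, hy⟩
    rw [Set.mem_Iio] at hx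
    have := hw y
    linarith
  -- If `a < α` and `α ∈ a + range w`, the intermediate value theorem puts all of `[a, α]` into `S`,
  -- so the component of `α` would reach left of `α`. Closedness of the range then gives a whole
  -- neighbourhood.
  · have hnot : α - a ∉ Set.range w := by
      rintro ⟨x₁, hx₁⟩
      obtain ⟨x₀, hx₀⟩ := hw₀
      have hsub : Set.Icc a α ⊆ S := fun y hy =>
        hS y (intermediate_value_univ x₀ x₁ w.continuous
          ⟨by rw [hx₀]; linarith [hy.1], by rw [hx₁]; linarith [hy.2]⟩)
      have := isPreconnected_Icc.subset_connectedComponentIn (Set.right_mem_Icc.2 h.le) hsub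
        (Set.left_mem_Icc.2 h.le)
      exact absurd (hα.2.2 this) (not_le.2 h)
    have hcl : IsClosed (Set.range w) := (isCompact_range w.continuous).isClosed
    have : ContinuousAt (fun x => x - a) α := by fun_prop
    exact (this.eventually (hcl.isOpen_compl.mem_nhds hnot)).filter_mono nhdsWithin_le_nhds

end Main

end Efimov

open Efimov in
theorem mainTheorem7
    (u v : C(I, ℝ)) (k₁ k₂ : C(I × I, ℂ))
    (hu : ∀ x, 0 ≤ u x) (hu₀ : ∃ x, u x = 0)
    (hv : ∀ y, 0 ≤ v y) (hv₀ : ∃ y, v y = 0)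
    (hk₁ : ∀ x s, k₁ (x, s) = star (k₁ (s, x)))
    (hk₂ : ∀ x s, k₂ (x, s) = star (k₂ (s, x)))
    (hK₁ : (integralOp k₁).IsPositive) (hK₂ : (integralOp k₂).IsPositive)
    (p : ℕ) (hp : 0 < p)
    (hH₁ : (discreteSpectrum (friedrichsOp u k₁)).encard = p)
    (hH₂ : (discreteSpectrum (friedrichsOp v k₂)).Infinite)
    (α : ℝ) (hα : α ∈ discreteSpectrum (friedrichsOp u k₁))
    (hS : α ∈ componentLeftEndpoints (essentialSpectrum (threeParticleOp u v k₁ k₂))) :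
    HasLeftEfimovEffect (threeParticleOp u v k₁ k₂) α ∧
      ∃ β : ℕ → ℝ, IsNegativeEigenvalueList (friedrichsOp v k₂) β ∧
        (∀ n, IsEigenvalue (threeParticleOp u v k₁ k₂) (α + β n)) ∧
        (∀ n, α + β n < α) ∧
        Tendsto (fun n => α + β n) atTop (𝓝 α) := by
  have ht := isHilbertTensor_tensorL2
  have hA := isSelfAdjoint_friedrichsOp u k₁ hK₁
  have hB := isSelfAdjoint_friedrichsOp v k₂ hK₂
  have hT₁ := friedrichsOp₁_tensor u k₁
  have hT₂ := friedrichsOp₂_tensor v k₂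
  have hT : ∀ f g, threeParticleOp u v k₁ k₂ (tensorL2 f g) =
      tensorL2 (friedrichsOp u k₁ f) g + tensorL2 f (friedrichsOp v k₂ g) := fun f g => by
    rw [threeParticleOp_eq, _root_.add_apply, hT₁, hT₂]
  have hTs : IsSelfAdjoint (threeParticleOp u v k₁ k₂) := by
    rw [threeParticleOp_eq]
    exact (ht.isSelfAdjoint hA hT₁).add (ht.flip.isSelfAdjoint hB fun y x => hT₂ x y)
  have hAneg : ∀ x < 0, IsSemiFredholmAt (friedrichsOp u k₁) x := fun x hx =>
    isSemiFredholmAt_friedrichsOp u k₁ (by rintro ⟨y, rfl⟩; exact (hu y).not_gt hx)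
  have hBneg : ∀ x < 0, IsSemiFredholmAt (friedrichsOp v k₂) x := fun x hx =>
    isSemiFredholmAt_friedrichsOp v k₂ (by rintro ⟨y, rfl⟩; exact (hv y).not_gt hx)
  have hα0 : α < 0 := neg_of_mem_discreteSpectrum hu hu₀ hK₁ hα
  obtain ⟨β, hβ, hβe, hβlim⟩ := exists_isNegativeEigenvalueList hB hBneg
    (fun x hx => neg_of_mem_discreteSpectrum hv hv₀ hK₂ hx) hH₂
  have heig : ∀ n, IsEigenvalue (threeParticleOp u v k₁ k₂) (α + β n) := fun n =>
    ht.isEigenvalue_add hT hα.2.2.1 (hβe n)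
  have hlt : ∀ n, α + β n < α := fun n => by linarith [hβ.2.1 n]
  have hlim : Tendsto (fun n => α + β n) atTop (𝓝 α) := by
    simpa using hβlim.const_add α
  refine ⟨⟨hS.1, ?_, fun n => α + β n, heig, hlt, hlim⟩, β, hβ, heig, hlt, hlim⟩
  -- Any `ε < -α / 2` works: every `x < α` is then below `-2ε`, where only finitely many eigenvalues
  -- of `H₁` and `H₂` matter.
  obtain ⟨ε, hε, hε'⟩ : ∃ ε > 0, α < -(2 * ε) := ⟨-α / 3, by linarith, by linarith⟩
  obtain ⟨ι, _, φ, a, C, hφ, hAφ, hC, hAf⟩ :=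
    exists_eigenvectors_of_isSemiFredholmAt hA hAneg hε
  obtain ⟨κ, _, ψ, b, D, hψ, hBψ, hD, hBf⟩ :=
    exists_eigenvectors_of_isSemiFredholmAt hB hBneg hε
  -- Each `a i + range v` lies in `σ_e(T)`, so the endpoint property of `α` applies to it;
  -- finiteness of the index type allows a common left neighbourhood.
  have h1 : ∀ᶠ x in 𝓝[<] α, ∀ i, x - a i ∉ Set.range v := eventually_all.2 fun i =>
    eventually_sub_notMem_range hS hv hv₀ fun y hy => (mem_essentialSpectrum_iff hTs).2 fun h =>
      (isSemiFredholmAt_friedrichsOp_iff v k₂).1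
        (ht.isSemiFredholmAt_right hT (hφ i) (hAφ i) h) hy
  have h2 : ∀ᶠ x in 𝓝[<] α, ∀ j, x - b j ∉ Set.range u := eventually_all.2 fun j =>
    eventually_sub_notMem_range hS hu hu₀ fun y hy => (mem_essentialSpectrum_iff hTs).2 fun h =>
      (isSemiFredholmAt_friedrichsOp_iff u k₁).1
        (ht.flip.isSemiFredholmAt_right (fun g f => (hT f g).trans (add_comm _ _))
          (hψ j) (hBψ j) h) hy
  have h3 : ∀ᶠ x in 𝓝[<] α, x ∉ essentialSpectrum (threeParticleOp u v k₁ k₂) := by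
    filter_upwards [h1, h2, self_mem_nhdsWithin] with x hx1 hx2 hxα hx
    refine (mem_essentialSpectrum_iff hTs).1 hx ?_
    rw [threeParticleOp_eq]
    exact ht.isSemiFredholmAt_add hA hB hT₁ hT₂ hC hD hφ hAφ hψ hBψ hAf hBf
      ((Set.mem_Iio.1 hxα).trans hε')
      (fun i => isSemiFredholmAt_friedrichsOp v k₂ (hx1 i))
      (fun j => isSemiFredholmAt_friedrichsOp u k₁ (hx2 j))
  obtain ⟨l, hl, hsub⟩ := (mem_nhdsLT_iff_exists_Ioo_subset).1 h3
  rw [Set.mem_Iio] at hl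
  refine ⟨α - l, sub_pos.2 hl, Set.eq_singleton_iff_unique_mem.2
    ⟨⟨⟨by linarith, le_rfl⟩, hS.1⟩, ?_⟩⟩
  rintro y ⟨⟨hy1, hy2⟩, hy⟩
  by_contra hne
  exact hsub ⟨by linarith, lt_of_le_of_ne hy2 hne⟩ hy
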